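/- There is a null series whose anti-analytic part is square-summable. That is, there is a family of complex numbers $(c(n))_{n\in\mathbb{Z}}$, not all zero, such that the trigonometric series $\sum_{n\in\mathbb{Z}} c(n)e^{int}$ converges to zero for Lebesgue-almost every $t\in\mathbb{T}=\mathbb{R}/2\pi\mathbb{Z}$, i.e. $\lim_{N\to\infty}\sum_{|n|\le N}c(n)e^{int}=0$ for almost every $t$, and $$\sum_{n<0}|c(n)|^2<\infty .$$ -/

import Mathlib

/-- The circle `ℝ / 2πℤ` is an `AddCircle` of positive length, so it carries Lebesgue measure. -/
instance fact_two_pi_pos : Fact (0 < 2 * Real.pi) := ⟨Real.two_pi_pos⟩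

/-- The `N`-th symmetric partial sum `∑_{|n| ≤ N} c(n) e^{int}` of the trigonometric series with
coefficients `c`, at a point `t` of `ℝ / 2πℤ`; here `fourier n t = e^{int}`. -/
noncomputable def trigPartialSum (c : ℤ → ℂ) (N : ℕ) (t : AddCircle (2 * Real.pi)) : ℂ :=
  ∑ n ∈ Finset.Icc (-(N : ℤ)) (N : ℤ), c n * fourier n t

/-- A null series: a trigonometric series, not all of whose coefficients vanish, that converges to
zero almost everywhere on the circle with respect to Lebesgue measure. -/
structure IsNullSeries (c : ℤ → ℂ) : Prop where
  nontrivial : ∃ n : ℤ, c n ≠ 0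
  tendsto_zero : ∀ᵐ t : AddCircle (2 * Real.pi) ∂MeasureTheory.volume,
    Filter.Tendsto (fun N : ℕ => trigPartialSum c N t) Filter.atTop (nhds 0)

/-!
Why a null series with square-summable anti-analytic part exists.

The model is `F = exp (μ + i μ̃)`, where `μ` is a positive singular measure and `μ̃` its conjugate
function: `F` is the reciprocal of a singular inner function. It is analytic in the disc, so it has
no negative frequencies, while its boundary function `f` is unimodular. Hence `F - f`, viewed as a
distribution, is nonzero, its negative coefficients are those of the bounded function `-f` and so
are square-summable, and it is carried by the closed support of `μ`. If this support is a null set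
and the coefficients of `F` tend to zero, then Rajchman's localisation principle
(`tendsto_trigPartialSum_of_convolution_eq_zero`) shows that the series of `F - f` converges to zero
off the support, hence almost everywhere.

The measure is reached through continuous densities `D_k`, with
`D_{k+1}(t) = D_k(t) W_k(N_k t)` and `N_k` large. The weight `W_k ≥ 0` has mean one and vanishes
outside a set of measure `2⁻ᵏ`, so the supports decrease to a null set, and on the complement `U_k`
of the support of `D_k` the function `F_k` hardly changes at later stages. Only trigonometric
polynomials `Re g_k` close to `D_k` enter `F_k = exp g_k`; for functions of the disc algebra with
real mean the real part controls the whole function in `L²` (`integral_norm_sq_le`), so no conjugate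
function has to be estimated.

The coefficients must tend to zero: the change `F_{k+1} - F_k` must have uniformly small Fourier
coefficients, although it is not small in mean. Up to an error tending to zero with `1 / N_k`
it equals `F_k(t) (exp (D_k(t) q_k(N_k t)) - 1)`, where `q_k` is analytic of mean zero with
`1 + Re q_k` close to `W_k`. For large `N` the coefficients of a function `G(t, N t)` are essentially
those of `G` on the two-dimensional torus (`eventually_norm_coeff_alongLine_le`), so it is enough that
`exp (x q_k) - 1` has small coefficients for bounded real `x`. This is achieved by composing a fixed
polynomial with an inner function `b` all of whose low powers have small coefficients; a lacunary
product of Blaschke factors `z (z - 1/2) / (1 - z/2)` has this property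
(`exists_inner_small_coeff`). Composition with `b` preserves the distribution of the weight
(`IsCenteredInner.integral_comp`), and hence the measure of its support.

For the final series no boundary function is needed: its coefficients are the limits of the Fourier
coefficients of `F_k` restricted to the complement of `U_k`.
-/

open MeasureTheory Polynomial Filter Topology AddCircle
open scoped ComplexConjugate

/-- The circle `ℝ / 2πℤ`. -/
abbrev Torus : Type := AddCircle (2 * Real.pi)

/-- Normalised Haar measure on the circle. -/
noncomputable abbrev torusHaar : Measure Torus := haarAddCircle

/-! ### Fourier coefficients -/

theorem norm_fourier_apply (n : ℤ) (t : Torus) : ‖fourier n t‖ = 1 := Circle.norm_coe _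

theorem norm_fourierCoeff_le_integral (f : Torus → ℂ) (n : ℤ) :
    ‖fourierCoeff f n‖ ≤ ∫ t, ‖f t‖ ∂torusHaar := by
  refine (norm_integral_le_integral_norm _).trans (le_of_eq ?_)
  refine integral_congr_ae (Eventually.of_forall fun t => ?_)
  simp only [norm_smul, norm_fourier_apply, one_mul]

theorem integrable_continuousMap (f : C(Torus, ℂ)) : Integrable f torusHaar :=
  f.continuous.integrable_of_hasCompactSupport (HasCompactSupport.of_compactSpace _)

theorem norm_fourierCoeff_le_norm (f : C(Torus, ℂ)) (n : ℤ) : ‖fourierCoeff f n‖ ≤ ‖f‖ := by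
  refine (norm_fourierCoeff_le_integral f n).trans ?_
  refine (integral_mono (integrable_continuousMap f).norm (integrable_const ‖f‖)
    (fun t => f.norm_coe_le_norm t)).trans ?_
  simp

theorem fourierCoeff_sub_of_integrable {f g : Torus → ℂ} (hf : Integrable f torusHaar)
    (hg : Integrable g torusHaar) (n : ℤ) :
    fourierCoeff (fun t => f t - g t) n = fourierCoeff f n - fourierCoeff g n := by
  simp only [fourierCoeff, smul_sub]
  exact integral_sub (hf.fourier_smul _) (hg.fourier_smul _)

/-- The `n`-th Fourier coefficient as a continuous linear functional on `C(Torus, ℂ)`. -/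
noncomputable def coeffCLM (n : ℤ) : C(Torus, ℂ) →L[ℂ] ℂ :=
  LinearMap.mkContinuous
    { toFun := fun f => fourierCoeff f n
      map_add' := fun f g => by
        have := congrFun (fourierCoeff.add (integrable_continuousMap f)
          (integrable_continuousMap g)) n
        simpa using this
      map_smul' := fun c f => by
        simpa using fourierCoeff.const_smul (f : Torus → ℂ) c n } 1
    (fun f => by simpa using norm_fourierCoeff_le_norm f n)

@[simp]
theorem coeffCLM_apply (n : ℤ) (f : C(Torus, ℂ)) : coeffCLM n f = fourierCoeff f n := rfl

theorem coeffCLM_fourier (n m : ℤ) :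
    coeffCLM n (fourier m : C(Torus, ℂ)) = if n = m then 1 else 0 := by
  rw [coeffCLM_apply, fourierCoeff_fourier]
  simp [Pi.single_apply]

theorem coeffCLM_fourier_mul (n m : ℤ) (f : C(Torus, ℂ)) :
    coeffCLM n (fourier m * f) = coeffCLM (n - m) f := by
  simp only [coeffCLM_apply, fourierCoeff, ContinuousMap.mul_apply, smul_eq_mul]
  refine integral_congr_ae (Eventually.of_forall fun t => ?_)
  simp only
  rw [show -(n - m) = -n + m by ring, fourier_add, mul_assoc]

theorem coeffCLM_zero_eq_integral (f : C(Torus, ℂ)) : coeffCLM 0 f = ∫ t, f t ∂torusHaar := by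
  simp [fourierCoeff]

theorem coeffCLM_one (n : ℤ) : coeffCLM n (1 : C(Torus, ℂ)) = if n = 0 then 1 else 0 := by
  have : (1 : C(Torus, ℂ)) = fourier 0 := by ext t; exact (fourier_zero).symm
  rw [this, coeffCLM_fourier]

/-- Parseval's identity for square-integrable functions on the circle. -/
theorem hasSum_sq_fourierCoeff_of_memLp {f : Torus → ℂ} (hf : MemLp f 2 torusHaar) :
    HasSum (fun n => ‖fourierCoeff f n‖ ^ 2) (∫ t, ‖f t‖ ^ 2 ∂torusHaar) := by
  have h := hasSum_sq_fourierCoeff hf.toLp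
  have e : (hf.toLp : Torus → ℂ) =ᵐ[torusHaar] f := hf.coeFn_toLp
  rw [fourierCoeff_congr_ae e] at h
  convert h using 1
  refine integral_congr_ae ?_
  filter_upwards [e] with t ht
  rw [ht]

theorem memLp_continuousMap (f : C(Torus, ℂ)) : MemLp f 2 torusHaar :=
  f.continuous.memLp_of_hasCompactSupport (HasCompactSupport.of_compactSpace _)

/-! ### The disc algebra -/

/-- Analytic trigonometric polynomials: polynomials in `e^{it}`. -/
noncomputable def analyticPoly : Subalgebra ℂ C(Torus, ℂ) := Algebra.adjoin ℂ {fourier 1}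

/-- The disc algebra, as the uniform closure of the analytic trigonometric polynomials. -/
noncomputable def discAlgebra : Subalgebra ℂ C(Torus, ℂ) := analyticPoly.topologicalClosure

theorem analyticPoly_le_discAlgebra : analyticPoly ≤ discAlgebra :=
  Subalgebra.le_topologicalClosure _

theorem isClosed_discAlgebra : IsClosed (discAlgebra : Set C(Torus, ℂ)) :=
  Subalgebra.isClosed_topologicalClosure _

theorem fourier_one_pow (n : ℕ) : (fourier 1 : C(Torus, ℂ)) ^ n = fourier n := by
  induction n with
  | zero => ext t; simp
  | succ n ih =>
    rw [pow_succ, ih]; ext t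
    rw [ContinuousMap.mul_apply, ← fourier_add]; norm_cast

theorem fourier_nat_mem_analyticPoly (n : ℕ) : (fourier n : C(Torus, ℂ)) ∈ analyticPoly := by
  rw [← fourier_one_pow]
  have h : (fourier 1 : C(Torus, ℂ)) ∈ analyticPoly :=
    Algebra.subset_adjoin (Set.mem_singleton _)
  exact pow_mem h n

theorem mem_analyticPoly_iff {f : C(Torus, ℂ)} :
    f ∈ analyticPoly ↔ ∃ p : ℂ[X], aeval (fourier 1 : C(Torus, ℂ)) p = f := by
  rw [analyticPoly, Algebra.adjoin_singleton_eq_range_aeval, AlgHom.mem_range]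

/-- A closed property of continuous functions that holds for polynomials in `e^{it}` holds on the
whole disc algebra. -/
theorem discAlgebra_induction {P : C(Torus, ℂ) → Prop} (hc : IsClosed {f | P f})
    (hp : ∀ p : ℂ[X], P (aeval (fourier 1 : C(Torus, ℂ)) p)) {f : C(Torus, ℂ)}
    (hf : f ∈ discAlgebra) : P f := by
  have : f ∈ closure (analyticPoly : Set C(Torus, ℂ)) := hf
  refine closure_minimal (t := {f | P f}) ?_ hc this
  intro g hg
  obtain ⟨p, rfl⟩ := mem_analyticPoly_iff.1 hg
  exact hp p

theorem aeval_fourier_eq_sum (p : ℂ[X]) :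
    aeval (fourier 1 : C(Torus, ℂ)) p = ∑ i ∈ p.support, p.coeff i • (fourier i : C(Torus, ℂ)) := by
  rw [aeval_eq_sum_range]
  simp_rw [fourier_one_pow]
  rw [Finset.sum_subset (s₁ := p.support) (s₂ := Finset.range (p.natDegree + 1))]
  · exact supp_subset_range_natDegree_succ
  · intro i _ hi; simp [notMem_support_iff.1 hi]

theorem coeffCLM_aeval (p : ℂ[X]) (n : ℤ) :
    coeffCLM n (aeval (fourier 1 : C(Torus, ℂ)) p) = if 0 ≤ n then p.coeff n.toNat else 0 := by
  rw [aeval_fourier_eq_sum, map_sum]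
  simp_rw [map_smul, coeffCLM_fourier]
  split_ifs with h
  · rw [Finset.sum_eq_single n.toNat]
    · rw [if_pos (by omega)]; simp
    · intro i _ hi; rw [if_neg (by omega)]; simp
    · intro hi; simp [notMem_support_iff.1 hi]
  · refine Finset.sum_eq_zero fun i _ => ?_
    rw [if_neg (by omega)]; simp

theorem coeffCLM_neg_of_mem {f : C(Torus, ℂ)} (hf : f ∈ discAlgebra) {n : ℤ} (hn : n < 0) :
    coeffCLM n f = 0 := by
  refine discAlgebra_induction (P := fun f => coeffCLM n f = 0) ?_ ?_ hf
  · exact isClosed_eq (coeffCLM n).continuous continuous_const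
  · intro p; rw [coeffCLM_aeval, if_neg (by omega)]

/-- The mean is multiplicative on the disc algebra: it is evaluation at the centre of the disc. -/
theorem mean_mul {f g : C(Torus, ℂ)} (hf : f ∈ discAlgebra) (hg : g ∈ discAlgebra) :
    coeffCLM 0 (f * g) = coeffCLM 0 f * coeffCLM 0 g := by
  refine discAlgebra_induction
    (P := fun f => coeffCLM 0 (f * g) = coeffCLM 0 f * coeffCLM 0 g) ?_ ?_ hf
  · exact isClosed_eq (by fun_prop) (by fun_prop)
  · intro p
    refine discAlgebra_induction (P := fun g => coeffCLM 0 (aeval (fourier 1) p * g) =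
      coeffCLM 0 (aeval (fourier 1) p) * coeffCLM 0 g) ?_ ?_ hg
    · exact isClosed_eq (by fun_prop) (by fun_prop)
    · intro r
      rw [← map_mul]
      simp only [coeffCLM_aeval, le_refl, if_true, Int.toNat_zero, mul_coeff_zero]

theorem mean_pow {f : C(Torus, ℂ)} (hf : f ∈ discAlgebra) (n : ℕ) :
    coeffCLM 0 (f ^ n) = coeffCLM 0 f ^ n := by
  induction n with
  | zero => simp [-coeffCLM_apply, coeffCLM_one]
  | succ n ih => rw [pow_succ, mean_mul (pow_mem hf n) hf, ih, pow_succ]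

theorem mean_aeval {b : C(Torus, ℂ)} (hb : b ∈ discAlgebra) (h0 : coeffCLM 0 b = 0) (p : ℂ[X]) :
    coeffCLM 0 (aeval b p) = p.coeff 0 := by
  rw [aeval_eq_sum_range, map_sum, Finset.sum_eq_single 0]
  · simp [-coeffCLM_apply, coeffCLM_one]
  · intro i _ hi
    rw [map_smul, mean_pow hb, h0, zero_pow hi, smul_zero]
  · simp

theorem exp_mem_discAlgebra {f : C(Torus, ℂ)} (hf : f ∈ discAlgebra) :
    NormedSpace.exp f ∈ discAlgebra := by
  have h := NormedSpace.exp_series_hasSum_exp' (𝕂 := ℂ) f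
  refine isClosed_discAlgebra.mem_of_tendsto h (Eventually.of_forall fun s => ?_)
  exact sum_mem fun i _ => Subalgebra.smul_mem _ (pow_mem hf i) _

theorem exp_continuousMap_apply (f : C(Torus, ℂ)) (t : Torus) :
    NormedSpace.exp f t = Complex.exp (f t) := by
  have h := NormedSpace.exp_series_hasSum_exp' (𝕂 := ℂ) f
  have h1 := (ContinuousMap.evalCLM ℂ t).hasSum h
  have h2 := NormedSpace.exp_series_hasSum_exp' (𝕂 := ℂ) (f t)
  rw [Complex.exp_eq_exp_ℂ]
  refine h1.unique (h2.congr_fun ?_)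
  intro i; simp

/-- Precomposition with `t ↦ N t`, as an algebra homomorphism. -/
noncomputable def dilate (N : ℕ) : C(Torus, ℂ) →ₐ[ℂ] C(Torus, ℂ) :=
  ContinuousMap.compRightAlgHom ℂ ℂ ⟨fun t : Torus => N • t, continuous_nsmul N⟩

@[simp]
theorem dilate_apply (N : ℕ) (f : C(Torus, ℂ)) (t : Torus) : dilate N f t = f (N • t) := rfl

theorem continuous_dilate (N : ℕ) : Continuous (dilate N) :=
  ContinuousMap.continuous_precomp _

theorem dilate_fourier (N : ℕ) (n : ℤ) :
    dilate N (fourier n : C(Torus, ℂ)) = fourier (n * N) := by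
  ext t
  simp only [dilate_apply, fourier_apply, mul_zsmul, natCast_zsmul]

theorem aeval_mem_of_mem {S : Subalgebra ℂ C(Torus, ℂ)} {b : C(Torus, ℂ)} (hb : b ∈ S)
    (p : ℂ[X]) : aeval b p ∈ S :=
  Algebra.adjoin_le (Set.singleton_subset_iff.2 hb) (aeval_mem_adjoin_singleton ℂ b)

theorem dilate_mem {f : C(Torus, ℂ)} (hf : f ∈ discAlgebra) (N : ℕ) : dilate N f ∈ discAlgebra := by
  refine discAlgebra_induction (P := fun f => dilate N f ∈ discAlgebra) ?_ ?_ hf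
  · exact isClosed_discAlgebra.preimage (continuous_dilate N)
  · intro p
    rw [← Polynomial.aeval_algHom_apply, dilate_fourier, one_mul]
    refine analyticPoly_le_discAlgebra ?_
    exact aeval_mem_of_mem (fourier_nat_mem_analyticPoly N) p

/-- An element of the disc algebra vanishing at the centre is divisible by `e^{it}`. -/
theorem fourier_neg_one_mul_mem {q : C(Torus, ℂ)} (hq : q ∈ discAlgebra) (h0 : coeffCLM 0 q = 0) :
    fourier (-1) * q ∈ discAlgebra := by
  have key : fourier (-1) * (q - algebraMap ℂ _ (coeffCLM 0 q)) ∈ discAlgebra := by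
    refine discAlgebra_induction
      (P := fun q => fourier (-1) * (q - algebraMap ℂ _ (coeffCLM 0 q)) ∈ discAlgebra) ?_ ?_ hq
    · refine isClosed_discAlgebra.preimage ?_
      have : Continuous (algebraMap ℂ C(Torus, ℂ)) := continuous_algebraMap _ _
      fun_prop
    · intro p
      obtain ⟨r, hr⟩ := Polynomial.X_dvd_sub_C (p := p)
      have h1 : aeval (fourier 1 : C(Torus, ℂ)) p
          - algebraMap ℂ _ (coeffCLM 0 (aeval (fourier 1 : C(Torus, ℂ)) p))
          = fourier 1 * aeval (fourier 1) r := by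
        rw [coeffCLM_aeval, if_pos le_rfl, Int.toNat_zero, ← aeval_C (R := ℂ)
          (fourier 1 : C(Torus, ℂ)), ← map_sub, hr, map_mul, aeval_X]
      rw [h1, ← mul_assoc]
      have h2 : (fourier (-1) * fourier 1 : C(Torus, ℂ)) = 1 := by
        ext t; rw [ContinuousMap.mul_apply, ← fourier_add]; simp
      rw [h2, one_mul]
      exact analyticPoly_le_discAlgebra (mem_analyticPoly_iff.2 ⟨r, rfl⟩)
  rwa [h0, map_zero, sub_zero] at key

/-- For a function of the disc algebra with real mean, the `L²` norm is controlled by the real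
part: the imaginary part of the mean of `h²` vanishes and its real part is nonnegative. -/
theorem integral_norm_sq_le {h : C(Torus, ℂ)} (hh : h ∈ discAlgebra)
    (him : (coeffCLM 0 h).im = 0) :
    ∫ t, ‖h t‖ ^ 2 ∂torusHaar ≤ 2 * ∫ t, (h t).re ^ 2 ∂torusHaar := by
  have h1 : 0 ≤ (coeffCLM 0 (h * h)).re := by
    rw [mean_mul hh hh, Complex.mul_re, him]; nlinarith [mul_self_nonneg (coeffCLM 0 h).re]
  rw [coeffCLM_zero_eq_integral] at h1
  have h2 := integral_re (integrable_continuousMap (h * h))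
  simp only [RCLike.re_eq_complex_re] at h2
  rw [← h2] at h1
  have hc (f : Torus → ℝ) (hf : Continuous f) : Integrable f torusHaar :=
    hf.integrable_of_hasCompactSupport (HasCompactSupport.of_compactSpace _)
  rw [← integral_const_mul, ← sub_nonneg, ← integral_sub (hc _ (by fun_prop)) (hc _ (by fun_prop))]
  convert h1 using 1
  refine integral_congr_ae (Eventually.of_forall fun t => ?_)
  simp only [ContinuousMap.mul_apply, Complex.mul_re, Complex.sq_norm, Complex.normSq_apply]
  ring

/-- Every real continuous function is uniformly approximable by real parts of analytic polynomials
with real mean. -/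
theorem exists_analyticPoly_re_close (D : C(Torus, ℝ)) {η : ℝ} (hη : 0 < η) :
    ∃ g ∈ analyticPoly, (coeffCLM 0 g).im = 0 ∧ ∀ t, |(g t).re - D t| ≤ η := by
  have hre : ∀ p ∈ Submodule.span ℂ (Set.range (fourier : ℤ → C(Torus, ℂ))), ∀ c : ℂ,
      ∃ g ∈ analyticPoly, ∀ t, (g t).re = (c * p t).re := by
    intro p hp
    induction hp using Submodule.span_induction with
    | mem p hp =>
      obtain ⟨n, rfl⟩ := hp
      intro c
      obtain ⟨m, rfl | rfl⟩ := Int.eq_nat_or_neg n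
      · exact ⟨c • fourier m, Subalgebra.smul_mem _ (fourier_nat_mem_analyticPoly m) c,
          fun t => by simp [-fourier_apply]⟩
      · refine ⟨conj c • fourier m, Subalgebra.smul_mem _ (fourier_nat_mem_analyticPoly m) _,
          fun t => ?_⟩
        rw [ContinuousMap.smul_apply, fourier_neg, smul_eq_mul, ← Complex.conj_re, map_mul,
          Complex.conj_conj]
    | zero => intro c; exact ⟨0, zero_mem _, by simp⟩
    | add x y _ _ hx hy =>
      intro c
      obtain ⟨g, hg, h1⟩ := hx c
      obtain ⟨g', hg', h2⟩ := hy c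
      exact ⟨g + g', add_mem hg hg', fun t => by
        simp only [ContinuousMap.add_apply, mul_add, Complex.add_re, h1, h2]⟩
    | smul a x _ hx =>
      intro c
      obtain ⟨g, hg, h1⟩ := hx (c * a)
      exact ⟨g, hg, fun t => by rw [h1, ContinuousMap.smul_apply, smul_eq_mul, mul_assoc]⟩
  let D' : C(Torus, ℂ) := ⟨fun t => (D t : ℂ), by fun_prop⟩
  have hD : D' ∈ closure (Submodule.span ℂ (Set.range (fourier : ℤ → C(Torus, ℂ))) :
      Set C(Torus, ℂ)) := by
    have := span_fourier_closure_eq_top (T := 2 * Real.pi)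
    rw [← Submodule.topologicalClosure_coe, this]; trivial
  obtain ⟨p, hp, hpD⟩ := Metric.mem_closure_iff.1 hD η hη
  obtain ⟨g, hg, hgp⟩ := hre p hp 1
  refine ⟨g - algebraMap ℂ _ (((coeffCLM 0 g).im : ℂ) * Complex.I),
    sub_mem hg (Subalgebra.algebraMap_mem _ _), ?_, fun t => ?_⟩
  · rw [map_sub, Algebra.algebraMap_eq_smul_one, map_smul, coeffCLM_one]
    simp [-coeffCLM_apply]
  · have h1 : ‖p t - D' t‖ ≤ η := by
      rw [dist_comm, dist_eq_norm] at hpD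
      exact ((p - D').norm_coe_le_norm t).trans hpD.le
    have h2 := (Complex.abs_re_le_norm (p t - D' t)).trans h1
    have h3 : (g t).re = (p t).re := by simpa using hgp t
    simpa [D', Algebra.algebraMap_eq_smul_one, h3, -coeffCLM_apply] using h2

/-- The complex conjugate of an analytic polynomial becomes analytic after multiplication by a
large power of `e^{it}`. -/
theorem exists_fourier_mul_star_mem {g : C(Torus, ℂ)} (hg : g ∈ analyticPoly) :
    ∃ d : ℕ, fourier d * star g ∈ analyticPoly := by
  induction hg using Algebra.adjoin_induction with
  | mem x hx =>
    rw [Set.mem_singleton_iff] at hx; subst hx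
    refine ⟨1, ?_⟩
    convert one_mem analyticPoly
    ext t
    rw [ContinuousMap.mul_apply, ContinuousMap.star_apply, RCLike.star_def, ← fourier_neg,
      ← fourier_add]
    simp
  | algebraMap r =>
    refine ⟨0, mul_mem (fourier_nat_mem_analyticPoly 0) ?_⟩
    rw [← algebraMap_star_comm]
    exact Subalgebra.algebraMap_mem _ _
  | add x y _ _ hx hy =>
    obtain ⟨d, hd⟩ := hx
    obtain ⟨e, he⟩ := hy
    refine ⟨d + e, ?_⟩
    have : (fourier ((d + e : ℕ) : ℤ) * star (x + y) : C(Torus, ℂ))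
        = fourier e * (fourier d * star x) + fourier d * (fourier e * star y) := by
      ext t
      simp only [ContinuousMap.mul_apply, ContinuousMap.add_apply, star_add, Nat.cast_add,
        fourier_add]
      ring
    rw [this]
    exact add_mem (mul_mem (fourier_nat_mem_analyticPoly e) hd)
      (mul_mem (fourier_nat_mem_analyticPoly d) he)
  | mul x y _ _ hx hy =>
    obtain ⟨d, hd⟩ := hx
    obtain ⟨e, he⟩ := hy
    refine ⟨d + e, ?_⟩
    have : (fourier ((d + e : ℕ) : ℤ) * star (x * y) : C(Torus, ℂ))
        = (fourier d * star x) * (fourier e * star y) := by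
      ext t
      simp only [ContinuousMap.mul_apply, star_mul', Nat.cast_add, fourier_add]
      ring
    rw [this]
    exact mul_mem hd he

/-- The real part of an analytic polynomial times a rapidly oscillating element of the disc
algebra with mean zero is again in the disc algebra, with mean zero. -/
theorem eventually_re_mul_dilate_mem {g q : C(Torus, ℂ)} (hg : g ∈ analyticPoly)
    (hq : q ∈ discAlgebra) (h0 : coeffCLM 0 q = 0) :
    ∀ᶠ N : ℕ in atTop, (g + star g) * dilate N q ∈ discAlgebra ∧
      coeffCLM 0 ((g + star g) * dilate N q) = 0 := by
  obtain ⟨d, hd⟩ := exists_fourier_mul_star_mem hg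
  filter_upwards [eventually_gt_atTop d] with N hN
  set r := dilate N (fourier (-1) * q)
  have hr : r ∈ discAlgebra := dilate_mem (fourier_neg_one_mul_mem hq h0) N
  -- both summands carry a positive power of `e^{it}`
  have e : (g + star g) * dilate N q =
      fourier 1 * (fourier ((N - 1 : ℕ) : ℤ) * g * r
        + fourier ((N - d - 1 : ℕ) : ℤ) * (fourier d * star g) * r) := by
    have e1 : (fourier 1 * fourier ((N - 1 : ℕ) : ℤ) * dilate N (fourier (-1)) : C(Torus, ℂ)) = 1 := by
      rw [dilate_fourier]; ext t
      simp only [ContinuousMap.mul_apply, ← fourier_add]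
      rw [show (1 + ((N - 1 : ℕ) : ℤ) + -1 * (N : ℤ)) = 0 by omega, fourier_zero]; rfl
    have e2 : (fourier 1 * fourier ((N - d - 1 : ℕ) : ℤ) * fourier d * dilate N (fourier (-1))
        : C(Torus, ℂ)) = 1 := by
      rw [dilate_fourier]; ext t
      simp only [ContinuousMap.mul_apply, ← fourier_add]
      rw [show (1 + ((N - d - 1 : ℕ) : ℤ) + d + -1 * (N : ℤ)) = 0 by omega, fourier_zero]; rfl
    simp only [r, map_mul]
    linear_combination (-g * dilate N q) * e1 + (- star g * dilate N q) * e2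
  have hm : fourier ((N - 1 : ℕ) : ℤ) * g * r
      + fourier ((N - d - 1 : ℕ) : ℤ) * (fourier d * star g) * r ∈ discAlgebra := by
    have hf (n : ℕ) := analyticPoly_le_discAlgebra (fourier_nat_mem_analyticPoly n)
    exact add_mem (mul_mem (mul_mem (hf _) (analyticPoly_le_discAlgebra hg)) hr)
      (mul_mem (mul_mem (hf _) (analyticPoly_le_discAlgebra hd)) hr)
  have h1 : (fourier 1 : C(Torus, ℂ)) ∈ discAlgebra :=
    analyticPoly_le_discAlgebra (Algebra.subset_adjoin (Set.mem_singleton _))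
  rw [e]
  refine ⟨mul_mem h1 hm, ?_⟩
  rw [mean_mul h1 hm, coeffCLM_fourier, if_neg (by decide), zero_mul]

/-! ### Restriction of functions of two variables to `(t, N t)` -/

/-- The monomial `e^{ilt} e^{ijs}` on the two-dimensional torus. -/
noncomputable def biFourier (i : ℤ × ℤ) : C(Torus × Torus, ℂ) :=
  (fourier i.1 : C(Torus, ℂ)).comp .fst * (fourier i.2 : C(Torus, ℂ)).comp .snd

theorem biFourier_apply (i : ℤ × ℤ) (x : Torus × Torus) :
    biFourier i x = fourier i.1 x.1 * fourier i.2 x.2 := rfl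

theorem biFourier_zero : biFourier 0 = 1 := by
  ext x; simp [biFourier_apply]

theorem biFourier_add (i j : ℤ × ℤ) : biFourier (i + j) = biFourier i * biFourier j := by
  ext x
  simp only [biFourier_apply, ContinuousMap.mul_apply, Prod.fst_add, Prod.snd_add, fourier_add]
  ring

theorem star_biFourier (i : ℤ × ℤ) : star (biFourier i) = biFourier (-i) := by
  ext x
  simp only [biFourier_apply, ContinuousMap.star_apply, Prod.fst_neg, Prod.snd_neg, fourier_neg,
    RCLike.star_def, map_mul]

/-- The star subalgebra of trigonometric polynomials in two variables. -/
noncomputable def biTrigPoly : StarSubalgebra ℂ C(Torus × Torus, ℂ) where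
  toSubalgebra := Algebra.adjoin ℂ (Set.range biFourier)
  star_mem' := by
    change Algebra.adjoin ℂ (Set.range biFourier) ≤ star (Algebra.adjoin ℂ (Set.range biFourier))
    refine Algebra.adjoin_le ?_
    rintro - ⟨n, rfl⟩
    exact Algebra.subset_adjoin ⟨-n, (star_biFourier n).symm⟩

theorem biTrigPoly_coe :
    Subalgebra.toSubmodule biTrigPoly.toSubalgebra = Submodule.span ℂ (Set.range biFourier) := by
  apply Algebra.adjoin_eq_span_of_subset
  refine Set.Subset.trans ?_ Submodule.subset_span
  intro x hx
  refine Submonoid.closure_induction (fun _ => id) ⟨0, biFourier_zero⟩ ?_ hx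
  rintro - - - - ⟨m, rfl⟩ ⟨n, rfl⟩
  exact ⟨m + n, biFourier_add m n⟩

theorem biTrigPoly_separatesPoints : biTrigPoly.SeparatesPoints := by
  intro x y hxy
  have hinj := injective_toCircle (T := 2 * Real.pi) Real.two_pi_pos.ne'
  by_cases h : x.1 = y.1
  · have h2 : x.2 ≠ y.2 := fun h2 => hxy (Prod.ext h h2)
    refine ⟨_, ⟨biFourier (0, 1), Algebra.subset_adjoin ⟨_, rfl⟩, rfl⟩, ?_⟩
    simp only [biFourier_apply, fourier_zero, one_mul, fourier_one]
    exact fun e => h2 (hinj (Subtype.coe_injective e))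
  · refine ⟨_, ⟨biFourier (1, 0), Algebra.subset_adjoin ⟨_, rfl⟩, rfl⟩, ?_⟩
    simp only [biFourier_apply, fourier_zero, mul_one, fourier_one]
    exact fun e => h (hinj (Subtype.coe_injective e))

theorem exists_biTrigPoly_close (G : C(Torus × Torus, ℂ)) {η : ℝ} (hη : 0 < η) :
    ∃ c : (ℤ × ℤ) →₀ ℂ, ‖G - c.sum fun i a => a • biFourier i‖ ≤ η := by
  have h := ContinuousMap.starSubalgebra_topologicalClosure_eq_top_of_separatesPoints biTrigPoly
    biTrigPoly_separatesPoints
  have hG : G ∈ closure (biTrigPoly : Set C(Torus × Torus, ℂ)) := by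
    rw [← StarSubalgebra.topologicalClosure_coe, h]; trivial
  obtain ⟨P, hP, hd⟩ := Metric.mem_closure_iff.1 hG η hη
  have hP' : P ∈ Subalgebra.toSubmodule biTrigPoly.toSubalgebra := hP
  rw [biTrigPoly_coe, Finsupp.mem_span_range_iff_exists_finsupp] at hP'
  obtain ⟨c, rfl⟩ := hP'
  exact ⟨c, by rw [← dist_eq_norm]; exact hd.le⟩

/-- The `j`-th Fourier coefficient in the second variable, as a continuous function of the first
variable. -/
noncomputable def partialCoeff (j : ℤ) (G : C(Torus × Torus, ℂ)) : C(Torus, ℂ) :=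
  ⟨fun t => coeffCLM j (G.curry t), by fun_prop⟩

theorem partialCoeff_apply (j : ℤ) (G : C(Torus × Torus, ℂ)) (t : Torus) :
    partialCoeff j G t = fourierCoeff (fun s => G (t, s)) j := rfl

/-- The `(l, j)`-th Fourier coefficient of a function on the two-dimensional torus. -/
noncomputable def biCoeff (i : ℤ × ℤ) : C(Torus × Torus, ℂ) →ₗ[ℂ] ℂ where
  toFun G := coeffCLM i.1 (partialCoeff i.2 G)
  map_add' G H := by
    rw [← map_add]; congr 1; ext t
    simp only [partialCoeff, ContinuousMap.coe_mk, ContinuousMap.add_apply, ← map_add]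
    rfl
  map_smul' a G := by
    rw [RingHom.id_apply, ← map_smul]; congr 1; ext t
    simp only [partialCoeff, ContinuousMap.coe_mk, ContinuousMap.smul_apply, ← map_smul]
    rfl

theorem biCoeff_apply (i : ℤ × ℤ) (G : C(Torus × Torus, ℂ)) :
    biCoeff i G = coeffCLM i.1 (partialCoeff i.2 G) := rfl

theorem norm_biCoeff_le (i : ℤ × ℤ) (G : C(Torus × Torus, ℂ)) : ‖biCoeff i G‖ ≤ ‖G‖ := by
  refine (norm_fourierCoeff_le_norm _ _).trans
    ((ContinuousMap.norm_le _ (norm_nonneg _)).2 fun t => ?_)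
  refine (norm_fourierCoeff_le_norm (G.curry t) _).trans
    ((ContinuousMap.norm_le _ (norm_nonneg _)).2 fun s => ?_)
  exact G.norm_coe_le_norm (t, s)

theorem biCoeff_biFourier (i j : ℤ × ℤ) : biCoeff i (biFourier j) = if i = j then 1 else 0 := by
  have h : partialCoeff i.2 (biFourier j)
      = (if i.2 = j.2 then (1 : ℂ) else 0) • (fourier j.1 : C(Torus, ℂ)) := by
    ext t
    have : (biFourier j).curry t = (fourier j.1 t) • (fourier j.2 : C(Torus, ℂ)) := by
      ext s; rfl
    rw [partialCoeff, ContinuousMap.coe_mk, this, map_smul, coeffCLM_fourier,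
      ContinuousMap.smul_apply, smul_eq_mul, smul_eq_mul, mul_comm]
  rw [biCoeff_apply, h, map_smul, coeffCLM_fourier]
  by_cases h1 : i.1 = j.1 <;> by_cases h2 : i.2 = j.2 <;> simp [h1, h2, Prod.ext_iff]

/-- The function `t ↦ G(t, N t)`. -/
noncomputable def alongLine (N : ℕ) (G : C(Torus × Torus, ℂ)) : C(Torus, ℂ) :=
  G.comp ⟨fun t => (t, N • t), by fun_prop⟩

@[simp]
theorem alongLine_apply (N : ℕ) (G : C(Torus × Torus, ℂ)) (t : Torus) :
    alongLine N G t = G (t, N • t) := rfl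

theorem alongLine_biFourier (N : ℕ) (i : ℤ × ℤ) :
    alongLine N (biFourier i) = fourier (i.1 + i.2 * N) := by
  ext t
  rw [alongLine_apply, biFourier_apply, fourier_add]
  simp only [fourier_apply, mul_zsmul, natCast_zsmul]

/-- **Two-scale principle.** As `N → ∞` the Fourier coefficients of `G(t, N t)` are, up to a uniformly
small error, among the Fourier coefficients of `G` on the two-dimensional torus: for a
trigonometric polynomial `G` and large `N`, the frequencies `l + j N` are pairwise distinct. -/
theorem eventually_norm_coeff_alongLine_le (G : C(Torus × Torus, ℂ)) {σ : ℝ}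
    (hσ : ∀ i, ‖biCoeff i G‖ ≤ σ) {η : ℝ} (hη : 0 < η) :
    ∀ᶠ N : ℕ in atTop, ∀ n, ‖coeffCLM n (alongLine N G)‖ ≤ σ + η := by
  obtain ⟨c, hc⟩ := exists_biTrigPoly_close G (half_pos hη)
  set P : C(Torus × Torus, ℂ) := c.sum fun i a => a • biFourier i with hP
  have hcoef (i : ℤ × ℤ) : ‖c i‖ ≤ σ + η / 2 := by
    have h1 : biCoeff i P = c i := by
      rw [hP, Finsupp.sum, map_sum]
      simp only [map_smul, biCoeff_biFourier, smul_eq_mul, mul_ite, mul_one, mul_zero]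
      rw [Finset.sum_ite_eq]
      split_ifs with h
      · rfl
      · exact (Finsupp.notMem_support_iff.1 h).symm
    have h2 : c i = biCoeff i G - biCoeff i (G - P) := by rw [map_sub, h1]; ring
    rw [h2]
    exact (norm_sub_le _ _).trans (add_le_add (hσ i) ((norm_biCoeff_le i _).trans hc))
  have hσ0 : 0 ≤ σ := (norm_nonneg _).trans (hσ 0)
  filter_upwards [eventually_gt_atTop (2 * c.support.sup fun i => i.1.natAbs)] with N hN n
  have hL (i) (hi : i ∈ c.support) : i.1.natAbs ≤ c.support.sup fun i => i.1.natAbs :=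
    Finset.le_sup (f := fun i : ℤ × ℤ => i.1.natAbs) hi
  set L := c.support.sup fun i => i.1.natAbs
  have hinj (i) (hi : i ∈ c.support) (j) (hj : j ∈ c.support)
      (h : i.1 + i.2 * N = j.1 + j.2 * N) : i = j := by
    have h1 := hL i hi
    have h2 := hL j hj
    have h3 : (i.2 - j.2) * N = j.1 - i.1 := by linarith
    have h5 : j.1 - i.1 = 0 := by
      refine Int.eq_zero_of_abs_lt_dvd (m := N) ⟨_, by rw [← h3, mul_comm]⟩ ?_
      rw [abs_lt]; omega
    have h4 : i.2 - j.2 = 0 := by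
      rw [h5] at h3
      exact (mul_eq_zero.1 h3).resolve_right (by omega)
    rw [h4] at h3
    exact Prod.ext (by omega) (by omega)
  have hPn : coeffCLM n (alongLine N P)
      = ∑ i ∈ c.support, if n = i.1 + i.2 * N then c i else 0 := by
    have : alongLine N P = ∑ i ∈ c.support, c i • (fourier (i.1 + i.2 * N) : C(Torus, ℂ)) := by
      simp_rw [← alongLine_biFourier]
      ext t
      simp [hP, Finsupp.sum]
    rw [this, map_sum]
    simp only [map_smul, coeffCLM_fourier, smul_eq_mul, mul_ite, mul_one, mul_zero]
  have hPb : ‖coeffCLM n (alongLine N P)‖ ≤ σ + η / 2 := by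
    rw [hPn]
    by_cases hex : ∃ i ∈ c.support, n = i.1 + i.2 * N
    · obtain ⟨i, hi, hin⟩ := hex
      rw [Finset.sum_eq_single_of_mem i hi, if_pos hin]
      · exact hcoef i
      · intro j hj hji
        rw [if_neg fun h => hji (hinj j hj i hi (h.symm.trans hin))]
    · push Not at hex
      rw [Finset.sum_eq_zero fun i hi => if_neg (hex i hi), norm_zero]
      positivity
  have hd : ‖coeffCLM n (alongLine N G - alongLine N P)‖ ≤ η / 2 := by
    refine (norm_fourierCoeff_le_norm _ _).trans
      ((ContinuousMap.norm_le _ (half_pos hη).le).2 fun t => ?_)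
    exact ((G - P).norm_coe_le_norm (t, N • t)).trans hc
  have : coeffCLM n (alongLine N G)
      = coeffCLM n (alongLine N P) + coeffCLM n (alongLine N G - alongLine N P) := by
    rw [map_sub]; ring
  rw [this]
  exact (norm_add_le _ _).trans (by linarith)

/-! ### Inner functions with small Fourier coefficients -/

/-- Unimodular functions of the disc algebra (finite Blaschke products) vanishing at the centre. -/
structure IsCenteredInner (b : C(Torus, ℂ)) : Prop where
  mem : b ∈ discAlgebra
  norm_eq_one : ∀ t, ‖b t‖ = 1
  mean_eq_zero : coeffCLM 0 b = 0

theorem fourier_one_mem_discAlgebra : (fourier 1 : C(Torus, ℂ)) ∈ discAlgebra :=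
  analyticPoly_le_discAlgebra (Algebra.subset_adjoin (Set.mem_singleton _))

theorem isCenteredInner_fourier_one : IsCenteredInner (fourier 1) where
  mem := fourier_one_mem_discAlgebra
  norm_eq_one := norm_fourier_apply 1
  mean_eq_zero := by rw [coeffCLM_fourier, if_neg (by decide)]

/-- The Blaschke factor `(z - 1/2) / (1 - z/2)`. -/
theorem exists_blaschke_factor :
    ∃ β ∈ discAlgebra, (∀ t : Torus, ‖β t‖ = 1) ∧ coeffCLM 0 β = -(1 / 2) := by
  set x : C(Torus, ℂ) := (1 / 2 : ℂ) • fourier 1 with hx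
  have hxn : ‖x‖ < 1 := by rw [hx, norm_smul, fourier_norm]; norm_num
  have hxm : x ∈ discAlgebra := Subalgebra.smul_mem _ fourier_one_mem_discAlgebra _
  set y : C(Torus, ℂ) := fourier 1 - algebraMap ℂ _ (1 / 2) with hy
  have hym : y ∈ discAlgebra :=
    sub_mem fourier_one_mem_discAlgebra (Subalgebra.algebraMap_mem _ _)
  have hsm : ∑' i : ℕ, x ^ i ∈ discAlgebra :=
    tsum_mem isClosed_discAlgebra fun i => pow_mem hxm i
  have hβ : (1 - x) * (y * ∑' i : ℕ, x ^ i) = y := by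
    rw [mul_left_comm, mul_neg_geom_series x hxn, mul_one]
  refine ⟨y * ∑' i : ℕ, x ^ i, mul_mem hym hsm, fun t => ?_, ?_⟩
  · have h1 := congrArg norm (DFunLike.congr_fun hβ t)
    rw [ContinuousMap.mul_apply, norm_mul] at h1
    have hz := norm_fourier_apply 1 t
    have h2 : ‖(1 - x) t‖ = ‖y t‖ := by
      simp only [hx, hy, ContinuousMap.sub_apply, ContinuousMap.one_apply,
        ContinuousMap.smul_apply, Algebra.algebraMap_eq_smul_one, smul_eq_mul, mul_one]
      rw [← sq_eq_sq₀ (norm_nonneg _) (norm_nonneg _)]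
      have h3 : Complex.normSq (fourier 1 t) = 1 := by rw [Complex.normSq_eq_norm_sq, hz, one_pow]
      rw [Complex.normSq_apply] at h3
      simp only [Complex.sq_norm, Complex.normSq_apply, Complex.sub_re, Complex.sub_im,
        Complex.mul_re, Complex.mul_im, Complex.one_re, Complex.one_im]
      norm_num [-fourier_apply]
      nlinarith [h3]
    have h4 : ‖y t‖ ≠ 0 := by
      simp only [hy, ContinuousMap.sub_apply, Algebra.algebraMap_eq_smul_one,
        ContinuousMap.smul_apply, ContinuousMap.one_apply, smul_eq_mul, mul_one]
      have := norm_sub_norm_le (fourier 1 t) (1 / 2 : ℂ)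
      rw [hz] at this
      norm_num at this
      norm_num
      intro h5
      rw [h5] at this
      norm_num at this
    rw [h2] at h1
    exact mul_left_cancel₀ h4 (by rw [h1, mul_one])
  · have h1 := congrArg (coeffCLM 0) hβ
    rw [mean_mul (sub_mem (one_mem _) hxm) (mul_mem hym hsm)] at h1
    simpa [hx, hy, -coeffCLM_apply, -one_div, coeffCLM_one, coeffCLM_fourier,
      Algebra.algebraMap_eq_smul_one] using h1

/-- A unimodular function whose mean is neither `0` nor unimodular has Fourier coefficients bounded
away from `1`, by Bessel's inequality for two coefficients. -/
theorem exists_norm_coeff_le_of_mean {f : C(Torus, ℂ)} (hf : ∀ t, ‖f t‖ = 1)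
    (h0 : coeffCLM 0 f ≠ 0) (h1 : ‖coeffCLM 0 f‖ < 1) :
    ∃ ρ < 1, ∀ j, ‖coeffCLM j f‖ ≤ ρ := by
  have hs := hasSum_sq_fourierCoeff_of_memLp (memLp_continuousMap f)
  simp only [hf, one_pow, integral_const, probReal_univ, smul_eq_mul, mul_one] at hs
  refine ⟨max ‖coeffCLM 0 f‖ (√(1 - ‖coeffCLM 0 f‖ ^ 2)), max_lt h1 ?_, fun j => ?_⟩
  · rw [Real.sqrt_lt' one_pos]
    have : 0 < ‖coeffCLM 0 f‖ := norm_pos_iff.2 h0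
    nlinarith
  · by_cases hj : j = 0
    · subst hj; exact le_max_left _ _
    · refine le_max_of_le_right (Real.le_sqrt_of_sq_le ?_)
      have := sum_le_hasSum {0, j} (fun i _ => by positivity) hs
      rw [Finset.sum_pair (Ne.symm hj)] at this
      simp only [coeffCLM_apply]
      linarith

/-- The function `f(t) g(s)` on the two-dimensional torus. -/
noncomputable def tensor (f g : C(Torus, ℂ)) : C(Torus × Torus, ℂ) := f.comp .fst * g.comp .snd

theorem biCoeff_tensor (f g : C(Torus, ℂ)) (i : ℤ × ℤ) :
    biCoeff i (tensor f g) = coeffCLM i.1 f * coeffCLM i.2 g := by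
  have h : partialCoeff i.2 (tensor f g) = coeffCLM i.2 g • f := by
    ext t
    have : (tensor f g).curry t = f t • g := by ext s; rfl
    rw [partialCoeff, ContinuousMap.coe_mk, this, map_smul, ContinuousMap.smul_apply, smul_eq_mul,
      smul_eq_mul, mul_comm]
  rw [biCoeff_apply, h, map_smul, smul_eq_mul, mul_comm]

theorem alongLine_tensor (N : ℕ) (f g : C(Torus, ℂ)) : alongLine N (tensor f g) = f * dilate N g :=
  rfl

theorem exists_lt_one_bound_Icc {ι : Type*} (a : ℕ → ι → ℝ)
    (h : ∀ n, 1 ≤ n → ∃ ρ < 1, ∀ j, a n j ≤ ρ) (n₀ : ℕ) :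
    ∃ ρ, 0 ≤ ρ ∧ ρ < 1 ∧ ∀ n ∈ Finset.Icc 1 n₀, ∀ j, a n j ≤ ρ := by
  induction n₀ with
  | zero => exact ⟨0, le_rfl, one_pos, by simp⟩
  | succ m ih =>
    obtain ⟨ρ, hρ0, hρ1, hρ⟩ := ih
    obtain ⟨r, hr1, hr⟩ := h (m + 1) (by omega)
    refine ⟨max ρ r, le_max_of_le_left hρ0, max_lt hρ1 hr1, fun n hn j => ?_⟩
    rw [Finset.mem_Icc] at hn
    by_cases hnm : n = m + 1
    · subst hnm; exact (hr j).trans (le_max_right _ _)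
    · exact (hρ n (Finset.mem_Icc.2 ⟨hn.1, by omega⟩) j).trans (le_max_left _ _)

/-- Lacunary products `∏ b₀(N_i t)` of a fixed Blaschke product `b₀` have powers with arbitrarily small
Fourier coefficients, since each new factor multiplies the largest coefficient by a number
less than one. -/
theorem exists_inner_small_coeff (n₀ : ℕ) {δ : ℝ} (hδ : 0 < δ) :
    ∃ b, IsCenteredInner b ∧ ∀ n ∈ Finset.Icc 1 n₀, ∀ j, ‖coeffCLM j (b ^ n)‖ ≤ δ := by
  obtain ⟨β, hβm, hβ1, hβ0⟩ := exists_blaschke_factor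
  set b₀ : C(Torus, ℂ) := fourier 1 * β with hb₀
  have hb₀m : b₀ ∈ discAlgebra := mul_mem fourier_one_mem_discAlgebra hβm
  have hb₀1 (t) : ‖b₀ t‖ = 1 := by
    rw [hb₀, ContinuousMap.mul_apply, norm_mul, norm_fourier_apply, hβ1, one_mul]
  obtain ⟨ρ, hρ0, hρ1, hρ⟩ := exists_lt_one_bound_Icc (fun n j => ‖coeffCLM j (b₀ ^ n)‖)
    (fun n hn => by
      obtain ⟨r, hr1, hr⟩ := exists_norm_coeff_le_of_mean (f := β ^ n)
        (fun t => by rw [ContinuousMap.pow_apply, norm_pow, hβ1, one_pow])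
        (by rw [mean_pow hβm, hβ0]; exact pow_ne_zero n (by norm_num))
        (by
          rw [mean_pow hβm, hβ0, norm_pow]
          exact pow_lt_one₀ (norm_nonneg _) (by norm_num) (by omega))
      refine ⟨r, hr1, fun j => ?_⟩
      rw [hb₀, mul_pow, fourier_one_pow, coeffCLM_fourier_mul]
      exact hr _) n₀
  have step : ∀ m : ℕ, ∃ b, IsCenteredInner b ∧
      ∀ n ∈ Finset.Icc 1 n₀, ∀ j, ‖coeffCLM j (b ^ n)‖ ≤ ((1 + ρ) / 2) ^ m := by
    intro m
    induction m with
    | zero =>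
      refine ⟨fourier 1, isCenteredInner_fourier_one, fun n _ j => ?_⟩
      rw [fourier_one_pow, pow_zero]
      exact (norm_fourierCoeff_le_norm _ j).trans (fourier_norm _).le
    | succ m ih =>
      obtain ⟨b, hb, hbn⟩ := ih
      have hη : 0 < ((1 + ρ) / 2) ^ m * ((1 - ρ) / 2) := by
        have : 0 < 1 - ρ := by linarith
        positivity
      have hev : ∀ᶠ N : ℕ in atTop, ∀ n ∈ Finset.Icc 1 n₀, ∀ j,
          ‖coeffCLM j (alongLine N (tensor (b ^ n) (b₀ ^ n)))‖
            ≤ ((1 + ρ) / 2) ^ m * ρ + ((1 + ρ) / 2) ^ m * ((1 - ρ) / 2) := by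
        rw [eventually_all_finset]
        intro n hn
        refine eventually_norm_coeff_alongLine_le _ (fun i => ?_) hη
        rw [biCoeff_tensor, norm_mul]
        exact mul_le_mul (hbn n hn _) (hρ n hn _) (norm_nonneg _) (by positivity)
      obtain ⟨N, hN⟩ := hev.exists
      have hd := dilate_mem hb₀m N
      refine ⟨b * dilate N b₀, ⟨mul_mem hb.mem hd, fun t => ?_, ?_⟩, fun n hn j => ?_⟩
      · rw [ContinuousMap.mul_apply, norm_mul, hb.norm_eq_one, dilate_apply, hb₀1, one_mul]
      · rw [mean_mul hb.mem hd, hb.mean_eq_zero, zero_mul]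
      · have h := hN n hn j
        rw [alongLine_tensor, map_pow, ← mul_pow] at h
        exact h.trans (le_of_eq (by ring))
  obtain ⟨m, hm⟩ := exists_pow_lt_of_lt_one hδ (show (1 + ρ) / 2 < 1 by linarith)
  obtain ⟨b, hb, hbn⟩ := step m
  exact ⟨b, hb, fun n hn j => (hbn n hn j).trans hm.le⟩

/-- The sum of the absolute values of the coefficients of a polynomial. -/
noncomputable def coeffNorm (p : ℂ[X]) : ℝ := ∑ i ∈ p.support, ‖p.coeff i‖

theorem coeffNorm_nonneg (p : ℂ[X]) : 0 ≤ coeffNorm p :=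
  Finset.sum_nonneg fun _ _ => norm_nonneg _

theorem norm_aeval_apply_le {b : C(Torus, ℂ)} (hb : ∀ t, ‖b t‖ = 1) (p : ℂ[X]) (t : Torus) :
    ‖aeval b p t‖ ≤ coeffNorm p := by
  rw [aeval_def, eval₂_eq_sum, Polynomial.sum, ContinuousMap.sum_apply]
  refine norm_sum_le_of_le _ fun i _ => ?_
  rw [← Algebra.smul_def, ContinuousMap.smul_apply, ContinuousMap.pow_apply, norm_smul, norm_pow,
    hb, one_pow, mul_one]

theorem norm_coeff_aeval_le {b : C(Torus, ℂ)} {n₀ : ℕ} {δ : ℝ}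
    (hb : ∀ n ∈ Finset.Icc 1 n₀, ∀ j, ‖coeffCLM j (b ^ n)‖ ≤ δ) {p : ℂ[X]} (h0 : p.coeff 0 = 0)
    (hd : p.natDegree ≤ n₀) (j : ℤ) : ‖coeffCLM j (aeval b p)‖ ≤ coeffNorm p * δ := by
  rw [aeval_def, eval₂_eq_sum, Polynomial.sum, map_sum, coeffNorm, Finset.sum_mul]
  refine norm_sum_le_of_le _ fun i hi => ?_
  rw [← Algebra.smul_def, map_smul, norm_smul]
  refine mul_le_mul_of_nonneg_left (hb i (Finset.mem_Icc.2 ⟨?_, ?_⟩) j) (norm_nonneg _)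
  · rw [Nat.one_le_iff_ne_zero]
    rintro rfl
    exact (mem_support_iff.1 hi) h0
  · exact (le_natDegree_of_mem_supp i hi).trans hd

/-- For a polynomial `p` vanishing at the origin there is an inner function `b` such that the
functions `exp (x p(b)) - 1` have uniformly small Fourier coefficients for bounded real `x`. -/
theorem exists_inner_exp_small_coeff (p : ℂ[X]) (h0 : p.coeff 0 = 0) {M ε : ℝ} (hM : 0 ≤ M)
    (hε : 0 < ε) :
    ∃ b, IsCenteredInner b ∧ ∀ x : ℝ, |x| ≤ M → ∀ j,
      ‖fourierCoeff (fun t => Complex.exp (x * aeval b p t) - 1) j‖ ≤ ε := by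
  set K := M * coeffNorm p with hK
  have hK0 : 0 ≤ K := mul_nonneg hM (coeffNorm_nonneg p)
  obtain ⟨I, hI1, hIK, hI⟩ : ∃ I : ℕ, 1 ≤ I ∧ 2 * K ≤ I ∧ K ^ I / I.factorial * 2 ≤ ε / 2 := by
    have h := (FloorSemiring.tendsto_pow_div_factorial_atTop K).mul_const 2
    rw [zero_mul] at h
    have := ((eventually_ge_atTop 1).and ((tendsto_natCast_atTop_atTop.eventually_ge_atTop
      (2 * K)).and (h.eventually_le_const (half_pos hε)))).exists
    exact this
  set A := ∑ i ∈ Finset.Ico 1 I, M ^ i * coeffNorm (p ^ i) with hA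
  have hA0 : 0 ≤ A :=
    Finset.sum_nonneg fun i _ => mul_nonneg (pow_nonneg hM i) (coeffNorm_nonneg _)
  obtain ⟨b, hb, hbn⟩ := exists_inner_small_coeff (I * p.natDegree)
    (show 0 < ε / 2 / (A + 1) by positivity)
  refine ⟨b, hb, fun x hx j => ?_⟩
  set f : C(Torus, ℂ) := (x : ℂ) • aeval b p with hf
  have hfK (t) : ‖f t‖ ≤ K := by
    rw [hf, ContinuousMap.smul_apply, norm_smul, Complex.norm_real, Real.norm_eq_abs]
    exact mul_le_mul hx (norm_aeval_apply_le hb.norm_eq_one p t) (norm_nonneg _) hM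
  -- the exponential is replaced by its Taylor polynomial
  set S : C(Torus, ℂ) := ∑ i ∈ Finset.range I, (i.factorial : ℂ)⁻¹ • f ^ i with hS
  set e : C(Torus, ℂ) := ⟨fun t => Complex.exp (f t), by fun_prop⟩
  have hrem : ‖e - S‖ ≤ ε / 2 := by
    refine (ContinuousMap.norm_le _ (half_pos hε).le).2 fun t => ?_
    have h1 : ‖f t‖ / I.succ ≤ 1 / 2 := by
      rw [div_le_iff₀ (by positivity), Nat.cast_succ]
      linarith [hfK t]
    have h2 := Complex.exp_bound' h1
    have h3 : S t = ∑ m ∈ Finset.range I, f t ^ m / m.factorial := by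
      rw [hS, ContinuousMap.sum_apply]
      refine Finset.sum_congr rfl fun i _ => ?_
      rw [ContinuousMap.smul_apply, ContinuousMap.pow_apply, smul_eq_mul, div_eq_inv_mul]
    rw [← h3] at h2
    refine h2.trans (le_trans ?_ hI)
    have := pow_le_pow_left₀ (norm_nonneg _) (hfK t) I
    gcongr
  have hpow (i) (hi : i ∈ Finset.Ico 1 I) : ‖coeffCLM j ((i.factorial : ℂ)⁻¹ • f ^ i)‖
      ≤ M ^ i * coeffNorm (p ^ i) * (ε / 2 / (A + 1)) := by
    rw [Finset.mem_Ico] at hi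
    have h1 : ‖coeffCLM j (aeval b (p ^ i))‖ ≤ coeffNorm (p ^ i) * (ε / 2 / (A + 1)) := by
      refine norm_coeff_aeval_le hbn ?_ ?_ j
      · rw [coeff_zero_eq_eval_zero, eval_pow, ← coeff_zero_eq_eval_zero, h0, zero_pow (by omega)]
      · exact natDegree_pow_le.trans (Nat.mul_le_mul_right _ hi.2.le)
    rw [hf, _root_.smul_pow, ← map_pow, map_smul, map_smul, norm_smul, norm_smul, norm_inv, norm_pow,
      Complex.norm_real, Real.norm_eq_abs, Complex.norm_natCast, mul_assoc]
    have h2 : ((i.factorial : ℝ))⁻¹ ≤ 1 :=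
      inv_le_one_of_one_le₀ (by exact_mod_cast i.factorial_pos)
    have h3 : |x| ^ i ≤ M ^ i := pow_le_pow_left₀ (abs_nonneg x) hx i
    calc _ ≤ 1 * (M ^ i * (coeffNorm (p ^ i) * (ε / 2 / (A + 1)))) := by gcongr
      _ = _ := one_mul _
  have hsplit : e - 1 = (e - S) + ∑ i ∈ Finset.Ico 1 I, (i.factorial : ℂ)⁻¹ • f ^ i := by
    rw [hS, Finset.sum_range_eq_add_Ico _ (by omega : 0 < I)]
    simp only [Nat.factorial_zero, Nat.cast_one, inv_one, pow_zero, one_smul]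
    ring
  have hgoal : fourierCoeff (fun t => Complex.exp (x * aeval b p t) - 1) j
      = coeffCLM j (e - 1) := rfl
  rw [hgoal, hsplit, map_add, map_sum]
  have hsum : ‖∑ i ∈ Finset.Ico 1 I, coeffCLM j ((i.factorial : ℂ)⁻¹ • f ^ i)‖ ≤ ε / 2 := by
    refine (norm_sum_le_of_le _ hpow).trans ?_
    rw [← Finset.sum_mul, ← hA, mul_div_assoc', div_le_iff₀ (by positivity)]
    nlinarith
  refine (norm_add_le _ _).trans ?_
  have := (norm_fourierCoeff_le_norm (e - S) j).trans hrem
  simp only [coeffCLM_apply] at hsum ⊢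
  linarith

/-! ### Building blocks -/

theorem integrable_of_continuous {E : Type*} [NormedAddCommGroup E] {f : Torus → E}
    (hf : Continuous f) : Integrable f torusHaar :=
  hf.integrable_of_hasCompactSupport (HasCompactSupport.of_compactSpace _)

theorem abs_integral_sub_le {f g : Torus → ℝ} (hf : Continuous f) (hg : Continuous g) {y : ℝ}
    (h : ∀ t, |f t - g t| ≤ y) :
    |∫ t, f t ∂torusHaar - ∫ t, g t ∂torusHaar| ≤ y := by
  rw [← integral_sub (integrable_of_continuous hf) (integrable_of_continuous hg)]
  refine (abs_integral_le_integral_abs).trans ?_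
  refine (integral_mono (integrable_of_continuous (by fun_prop)) (integrable_const y) h).trans ?_
  simp

theorem aeval_continuousMap_apply (b : C(Torus, ℂ)) (p : ℂ[X]) (t : Torus) :
    aeval b p t = p.eval (b t) := by
  rw [aeval_eq_sum_range, eval_eq_sum_range, ContinuousMap.sum_apply]
  simp

theorem re_mean (f : C(Torus, ℂ)) : (coeffCLM 0 f).re = ∫ t, (f t).re ∂torusHaar := by
  rw [coeffCLM_zero_eq_integral]
  exact (integral_re (integrable_continuousMap f)).symm

theorem exists_fourier_one_eq {z : ℂ} (hz : ‖z‖ = 1) : ∃ t : Torus, fourier 1 t = z := by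
  have hs : Function.Surjective (toCircle : Torus → Circle) := by
    intro c
    refine ⟨((Complex.arg c : ℝ) : Torus), ?_⟩
    rw [toCircle_apply_mk, div_self Real.two_pi_pos.ne', one_mul, Circle.exp_arg]
  obtain ⟨t, ht⟩ := hs ⟨z, by simpa [Submonoid.unitSphere] using hz⟩
  exact ⟨t, by rw [fourier_one, ht]⟩

/-- A continuous function on the unit circle is uniformly close to the real part of a
polynomial. -/
theorem exists_polynomial_re_close {φ : ℂ → ℝ} (hφ : Continuous φ) {η : ℝ} (hη : 0 < η) :
    ∃ p : ℂ[X], ∀ z : ℂ, ‖z‖ = 1 → |(p.eval z).re - φ z| ≤ η := by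
  obtain ⟨g, hg, -, hclose⟩ := exists_analyticPoly_re_close
    ⟨fun t => φ (fourier 1 t), hφ.comp (fourier 1 : C(Torus, ℂ)).continuous⟩ hη
  obtain ⟨p, rfl⟩ := mem_analyticPoly_iff.1 hg
  refine ⟨p, fun z hz => ?_⟩
  obtain ⟨t, rfl⟩ := exists_fourier_one_eq hz
  have := hclose t
  rwa [aeval_continuousMap_apply] at this

/-- A centred inner function transports Haar measure of the circle to itself, because
it preserves all moments. -/
theorem IsCenteredInner.integral_comp {b : C(Torus, ℂ)} (hb : IsCenteredInner b) {φ : ℂ → ℝ}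
    (hφ : Continuous φ) :
    ∫ t, φ (b t) ∂torusHaar = ∫ t, φ (fourier 1 t) ∂torusHaar := by
  have key {b : C(Torus, ℂ)} (hb : IsCenteredInner b) (p : ℂ[X]) {η : ℝ}
      (hp : ∀ z : ℂ, ‖z‖ = 1 → |(p.eval z).re - φ z| ≤ η) :
      |(p.coeff 0).re - ∫ t, φ (b t) ∂torusHaar| ≤ η := by
    have h1 := re_mean (aeval b p)
    rw [mean_aeval hb.mem hb.mean_eq_zero] at h1
    rw [h1]
    refine abs_integral_sub_le (by fun_prop) (by fun_prop) fun t => ?_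
    rw [aeval_continuousMap_apply]
    exact hp _ (hb.norm_eq_one t)
  rw [← sub_eq_zero, ← abs_nonpos_iff]
  refine le_of_forall_pos_le_add fun η hη => ?_
  obtain ⟨p, hp⟩ := exists_polynomial_re_close hφ (half_pos hη)
  have h1 := abs_le.1 (key hb p hp)
  have h2 := abs_le.1 (key isCenteredInner_fourier_one p hp)
  rw [zero_add, abs_le]
  constructor <;> linarith [h1.1, h1.2, h2.1, h2.2]

/-- Normalised Fejér kernels: nonnegative functions of small mean taking a value above `1`. -/
theorem exists_peak_function {κ : ℝ} (hκ : 0 < κ) :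
    ∃ u : ℂ → ℝ, Continuous u ∧ (∀ z, 0 ≤ u z) ∧ 1 < u 1 ∧
      ∫ t, u (fourier 1 t) ∂torusHaar ≤ κ := by
  obtain ⟨n, hn⟩ := exists_nat_gt (max 1 (2 / κ))
  have hn1 : (1 : ℝ) < n := (le_max_left _ _).trans_lt hn
  have hn2 : 2 / κ < n := (le_max_right _ _).trans_lt hn
  have hn0 : (0 : ℝ) < n := by linarith
  refine ⟨fun z => 2 / (n : ℝ) ^ 2 * ‖∑ j ∈ Finset.range n, z ^ j‖ ^ 2, by fun_prop,
    fun z => by positivity, ?_, ?_⟩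
  · simp only [one_pow, Finset.sum_const, Finset.card_range, nsmul_eq_mul, mul_one,
      Complex.norm_natCast]
    field_simp
    norm_num
  · have hsq : ∫ t : Torus, ‖∑ j ∈ Finset.range n, fourier 1 t ^ j‖ ^ 2 ∂torusHaar = n := by
      set f : C(Torus, ℂ) := ∑ j ∈ Finset.range n, ∑ l ∈ Finset.range n,
        fourier ((j : ℤ) - l) with hf
      have h1 : coeffCLM 0 f = n := by
        simp only [hf, map_sum, coeffCLM_fourier]
        have (j : ℕ) (hj : j ∈ Finset.range n) :
            ∑ l ∈ Finset.range n, (if (0 : ℤ) = (j : ℤ) - l then (1 : ℂ) else 0) = 1 := by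
          rw [Finset.sum_eq_single_of_mem j hj, if_pos (by omega)]
          intro l _ hl
          rw [if_neg (by omega)]
        rw [Finset.sum_congr rfl this]
        simp
      have h2 := re_mean f
      rw [h1, Complex.natCast_re] at h2
      rw [h2]
      refine integral_congr_ae (Eventually.of_forall fun t => ?_)
      have h3 (j : ℕ) : fourier 1 t ^ j = fourier (j : ℤ) t := by
        rw [← fourier_one_pow, ContinuousMap.pow_apply]
      have h4 : f t = (∑ j ∈ Finset.range n, fourier 1 t ^ j)
          * conj (∑ j ∈ Finset.range n, fourier 1 t ^ j) := by
        simp only [hf, ContinuousMap.sum_apply, map_sum, Finset.sum_mul_sum, h3, ← fourier_neg,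
          ← fourier_add, sub_eq_add_neg]
      simp only
      rw [h4, Complex.mul_conj, Complex.ofReal_re, Complex.normSq_eq_norm_sq]
    rw [integral_const_mul, hsq]
    rw [div_lt_iff₀ hκ] at hn2
    rw [div_mul_eq_mul_div, div_le_iff₀ (by positivity)]
    nlinarith

/-- A nonnegative weight of mean one on the circle, vanishing outside a set of small measure. -/
theorem exists_weight {κ : ℝ} (hκ : 0 < κ) :
    ∃ (u w : ℂ → ℝ) (R : ℝ), Continuous u ∧ (∀ z, 0 ≤ u z) ∧
      ∫ t, u (fourier 1 t) ∂torusHaar ≤ κ ∧ Continuous w ∧ 1 ≤ R ∧ (∀ z, 0 ≤ w z) ∧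
      (∀ z, ‖z‖ = 1 → w z ≤ R) ∧ (∀ z, u z < 1 → w z = 0) ∧
      ∫ t, w (fourier 1 t) ∂torusHaar = 1 := by
  obtain ⟨u, huc, hu0, hu1, huκ⟩ := exists_peak_function hκ
  set m := ∫ t, max (u (fourier 1 t) - 1) 0 ∂torusHaar with hm
  have hm0 : 0 < m := by
    refine Continuous.integral_pos_of_hasCompactSupport_nonneg_nonzero (x := 0) (by fun_prop)
      (HasCompactSupport.of_compactSpace _) (fun t => le_max_right _ _) ?_
    rw [fourier_eval_zero]
    exact ((sub_pos.2 hu1).trans_le (le_max_left _ _)).ne'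
  have hwc : Continuous fun z => max (u z - 1) 0 / m := by fun_prop
  obtain ⟨R, hR⟩ := (isCompact_sphere (0 : ℂ) 1).exists_bound_of_continuousOn hwc.continuousOn
  refine ⟨u, fun z => max (u z - 1) 0 / m, max 1 R, huc, hu0, huκ, hwc, le_max_left _ _,
    fun z => by positivity, fun z hz => ?_, fun z hz => ?_, ?_⟩
  · exact (le_abs_self _).trans ((hR z (by simpa using hz)).trans (le_max_right _ _))
  · simp only
    rw [max_eq_right (by linarith), zero_div]
  · rw [integral_div, ← hm, div_self hm0.ne']

/-- A building block: a weight `W` with values in `[0, R]` vanishing on an open set `E` of measure at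
least `1 - κ`, and an element `q` of the disc algebra of mean zero with `1 + Re q` close to `W`,
such that `exp (x q) - 1` has small Fourier coefficients for `x ∈ [-M, M]`. -/
structure IsBlock (κ R y Q M ε : ℝ) (W : C(Torus, ℝ)) (E : Set Torus) (q : C(Torus, ℂ)) : Prop where
  nonneg : ∀ t, 0 ≤ W t
  le : ∀ t, W t ≤ R
  isOpen : IsOpen E
  eq_zero : ∀ t ∈ E, W t = 0
  measure_compl : torusHaar.real Eᶜ ≤ κ
  mem : q ∈ discAlgebra
  mean_eq_zero : coeffCLM 0 q = 0
  norm_le : ∀ t, ‖q t‖ ≤ Q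
  close : ∀ t, |1 + (q t).re - W t| ≤ y
  coeff_le : ∀ x : ℝ, |x| ≤ M → ∀ j,
    ‖fourierCoeff (fun t => Complex.exp (x * q t) - 1) j‖ ≤ ε

/-- Building blocks exist; `R` depends on `κ` only, and `Q` does not depend on `M` and `ε`. -/
theorem exists_block {κ : ℝ} (hκ : 0 < κ) :
    ∃ R, 1 ≤ R ∧ ∀ y > 0, ∃ Q, 0 ≤ Q ∧ ∀ M ≥ 0, ∀ ε > 0, ∃ W E q, IsBlock κ R y Q M ε W E q := by
  obtain ⟨u, w, R, huc, hu0, huκ, hwc, hR, hw0, hwR, huw, hw1⟩ := exists_weight hκ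
  refine ⟨R, hR, fun y hy => ?_⟩
  obtain ⟨P, hP⟩ := exists_polynomial_re_close hwc (half_pos hy)
  set p : ℂ[X] := P - C (P.coeff 0) with hp
  have hp0 : p.coeff 0 = 0 := by simp [hp]
  have hPre : |(P.coeff 0).re - 1| ≤ y / 2 := by
    have h1 := re_mean (aeval (fourier 1) P)
    rw [mean_aeval isCenteredInner_fourier_one.mem isCenteredInner_fourier_one.mean_eq_zero] at h1
    rw [h1, ← hw1]
    refine abs_integral_sub_le (by fun_prop) (by fun_prop) fun t => ?_
    rw [aeval_continuousMap_apply]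
    exact hP _ (norm_fourier_apply 1 t)
  refine ⟨coeffNorm p, coeffNorm_nonneg p, fun M hM ε hε => ?_⟩
  obtain ⟨b, hb, hbexp⟩ := exists_inner_exp_small_coeff p hp0 hM hε
  refine ⟨⟨fun t => w (b t), by fun_prop⟩, {t | u (b t) < 1}, aeval b p,
    fun t => hw0 _, fun t => hwR _ (hb.norm_eq_one t), ?_, fun t ht => huw _ ht, ?_,
    aeval_mem_of_mem hb.mem p, ?_, norm_aeval_apply_le hb.norm_eq_one p, fun t => ?_, hbexp⟩
  · exact isOpen_lt (by fun_prop) continuous_const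
  · have h1 := mul_meas_ge_le_integral_of_nonneg (μ := torusHaar) (f := fun t => u (b t))
      (Eventually.of_forall fun t => hu0 _) (integrable_of_continuous (by fun_prop)) 1
    rw [hb.integral_comp huc, one_mul] at h1
    have h2 : {t | u (b t) < 1}ᶜ = {t | 1 ≤ u (b t)} := by ext t; simp
    rw [h2]
    exact h1.trans huκ
  · rw [mean_aeval hb.mem hb.mean_eq_zero, hp0]
  · have h1 := abs_le.1 (hP _ (hb.norm_eq_one t))
    have h2 := abs_le.1 hPre
    rw [aeval_continuousMap_apply, hp, eval_sub, eval_C, Complex.sub_re]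
    change |1 + ((eval (b t) P).re - (P.coeff 0).re) - w (b t)| ≤ y
    rw [abs_le]
    constructor <;> linarith [h1.1, h1.2, h2.1, h2.2]

/-! ### One step of the construction -/

/-- The data at one stage: a weight `D` with values in `[0, M]` vanishing on the open set `U`, and an
analytic polynomial `g` with real mean and `Re g` within `η` of `D`. -/
structure IsStage (M η : ℝ) (D : C(Torus, ℝ)) (U : Set Torus) (g : C(Torus, ℂ)) : Prop where
  isOpen : IsOpen U
  nonneg : ∀ t, 0 ≤ D t
  le : ∀ t, D t ≤ M
  eq_zero : ∀ t ∈ U, D t = 0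
  mem : g ∈ analyticPoly
  im_mean : (coeffCLM 0 g).im = 0
  close : ∀ t, |(g t).re - D t| ≤ η

/-- The exponential of a continuous function, as a continuous function. -/
noncomputable def expMap (g : C(Torus, ℂ)) : C(Torus, ℂ) := ⟨fun t => Complex.exp (g t), by fun_prop⟩

@[simp]
theorem expMap_apply (g : C(Torus, ℂ)) (t : Torus) : expMap g t = Complex.exp (g t) := rfl

theorem expMap_mem {g : C(Torus, ℂ)} (hg : g ∈ discAlgebra) : expMap g ∈ discAlgebra := by
  have : expMap g = NormedSpace.exp g := by ext t; rw [exp_continuousMap_apply]; rfl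
  rw [this]; exact exp_mem_discAlgebra hg

theorem norm_exp_sub_exp_le {a b : ℂ} {K : ℝ} (ha : a.re ≤ K) (hb : b.re ≤ K) :
    ‖Complex.exp a - Complex.exp b‖ ≤ Real.exp K * ‖a - b‖ := by
  refine (convex_halfSpace_re_le K).norm_image_sub_le_of_norm_hasDerivWithin_le
    (f' := Complex.exp) (fun x _ => (Complex.hasDerivAt_exp x).hasDerivWithinAt) (fun x hx => ?_)
    hb ha
  rw [Complex.norm_exp]
  exact Real.exp_le_exp.2 hx

/-- Comparison in mean of the exponentials of two functions of the disc algebra in terms of their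
real parts. -/
theorem integral_norm_exp_sub_le {g h : C(Torus, ℂ)} (hg : g ∈ discAlgebra) (hh : h ∈ discAlgebra)
    (gim : (coeffCLM 0 g).im = 0) (him : (coeffCLM 0 h).im = 0) {K θ : ℝ}
    (hgK : ∀ t, (g t).re ≤ K) (hhK : ∀ t, (h t).re ≤ K) (hθ : ∀ t, |(g t).re - (h t).re| ≤ θ) :
    ∫ t, ‖Complex.exp (g t) - Complex.exp (h t)‖ ∂torusHaar ≤ 2 * θ * Real.exp K := by
  have hθ0 : 0 ≤ θ := (abs_nonneg _).trans (hθ 0)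
  have h2 : ∫ t, ‖(g - h) t‖ ^ 2 ∂torusHaar ≤ 2 * θ ^ 2 := by
    refine (integral_norm_sq_le (sub_mem hg hh)
      (by rw [map_sub, Complex.sub_im, gim, him, sub_zero])).trans ?_
    refine mul_le_mul_of_nonneg_left ?_ zero_le_two
    refine (integral_mono (integrable_of_continuous (by fun_prop)) (integrable_const (θ ^ 2))
      fun t => ?_).trans (by simp)
    rw [← sq_abs]
    exact pow_le_pow_left₀ (abs_nonneg _) (by simpa using hθ t) 2
  -- the `L¹` norm is at most the `L²` norm, since the variance of `‖g - h‖` is nonnegative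
  have h1 : ∫ t, ‖(g - h) t‖ ∂torusHaar ≤ 2 * θ := by
    have hv : 0 ≤ ∫ t, (‖(g - h) t‖ - ∫ s, ‖(g - h) s‖ ∂torusHaar) ^ 2 ∂torusHaar :=
      integral_nonneg fun t => sq_nonneg _
    set m := ∫ s, ‖(g - h) s‖ ∂torusHaar with hm
    have he : ∫ t, (‖(g - h) t‖ - m) ^ 2 ∂torusHaar
        = ∫ t, ‖(g - h) t‖ ^ 2 ∂torusHaar - 2 * m * m + m ^ 2 := by
      have : ∀ t, (‖(g - h) t‖ - m) ^ 2 = ‖(g - h) t‖ ^ 2 - 2 * m * ‖(g - h) t‖ + m ^ 2 :=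
        fun t => by ring
      simp_rw [this]
      rw [integral_add (integrable_of_continuous (by fun_prop)) (integrable_const _),
        integral_sub (integrable_of_continuous (by fun_prop))
          (integrable_of_continuous (by fun_prop)), integral_const_mul, ← hm]
      simp
    rw [he] at hv
    nlinarith
  calc ∫ t, ‖Complex.exp (g t) - Complex.exp (h t)‖ ∂torusHaar
      ≤ ∫ t, Real.exp K * ‖(g - h) t‖ ∂torusHaar :=
        integral_mono (integrable_of_continuous (by fun_prop))
          (integrable_of_continuous (by fun_prop))
          fun t => norm_exp_sub_exp_le (hgK t) (hhK t)
    _ ≤ 2 * θ * Real.exp K := by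
        rw [integral_const_mul, mul_comm]
        exact mul_le_mul_of_nonneg_right h1 (Real.exp_pos K).le

/-- The inductive step. The weight `D` is replaced by `D(t) W(N t)` with large `N`. The change of
`exp g` has small Fourier coefficients by the two-scale principle, and it is small in mean on the
set `U`, where `D` vanishes. -/
theorem exists_next_stage {M R Q y η η' ε δ κ : ℝ} (hM : 0 ≤ M) (hR : 1 ≤ R)
    (hη' : 0 < η') (hη1 : η ≤ 1 / 2) (hδ : 0 < δ) (hδ1 : δ ≤ 1)
    (hηR : η * R ≤ δ * Real.exp (-(M * R + 1)) / 12)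
    (hη'τ : η' ≤ δ * Real.exp (-(M * R + 1)) / 12)
    (hyτ : (M + 1) * y ≤ δ * Real.exp (-(M * R + 1)) / 12)
    (hηQ : 12 * (η * Q) ≤ δ) (hε : ε * Real.exp (M + 1) ≤ δ / 4)
    {D : C(Torus, ℝ)} {U : Set Torus} {g : C(Torus, ℂ)} (hS : IsStage M η D U g)
    {W : C(Torus, ℝ)} {E : Set Torus} {q : C(Torus, ℂ)} (hB : IsBlock κ R y Q (M + 1) ε W E q) :
    ∃ D' U' g', IsStage (M * R) η' D' U' g' ∧ U ⊆ U' ∧ torusHaar.real U'ᶜ ≤ κ ∧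
      (∀ n, ‖coeffCLM n (expMap g' - expMap g)‖ ≤ δ) ∧
      ∫ t in U, ‖expMap g' t - expMap g t‖ ∂torusHaar ≤ δ := by
  have hη0 : 0 ≤ η := (abs_nonneg _).trans (hS.close 0)
  have hε0 : 0 ≤ ε := (norm_nonneg _).trans (hB.coeff_le 0 (by simpa using by linarith) 0)
  have hre (t) : |(g t).re| ≤ M + 1 := by
    have h1 := abs_le.1 (hS.close t)
    rw [abs_le]
    constructor <;> linarith [hS.nonneg t, hS.le t, h1.1, h1.2]
  set τ := δ * Real.exp (-(M * R + 1)) / 12 with hτ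
  have hτexp : τ * Real.exp (M * R + 1) = δ / 12 := by
    rw [hτ, Real.exp_neg]
    field_simp
  have hMR : 0 ≤ M * R := mul_nonneg hM (by linarith)
  have hτ1 : τ ≤ 1 / 12 := by
    have : Real.exp (-(M * R + 1)) ≤ 1 := Real.exp_le_one_iff.2 (by linarith)
    have := mul_le_one₀ hδ1 (Real.exp_pos _).le this
    rw [hτ]; linarith
  set G : C(Torus × Torus, ℂ) :=
    ⟨fun x => Complex.exp (g x.1) * (Complex.exp ((g x.1).re * q x.2) - 1), by fun_prop⟩ with hG
  have hGc (i) : ‖biCoeff i G‖ ≤ δ / 4 := by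
    refine (norm_fourierCoeff_le_norm _ _).trans
      ((ContinuousMap.norm_le _ (by linarith)).2 fun t => ?_)
    rw [partialCoeff_apply]
    have : (fun s => G (t, s))
      = fun s => Complex.exp (g t) * (Complex.exp ((g t).re * q s) - 1) := rfl
    rw [this, fourierCoeff.const_mul, norm_mul, Complex.norm_exp, mul_comm]
    refine le_trans ?_ hε
    exact mul_le_mul (hB.coeff_le _ (hre t) _)
      (Real.exp_le_exp.2 ((le_abs_self _).trans (hre t))) (Real.exp_pos _).le hε0
  obtain ⟨N, hN0, ⟨hNmem, hNmean⟩, hNG⟩ := ((eventually_gt_atTop 0).and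
    ((eventually_re_mul_dilate_mem hS.mem hB.mem hB.mean_eq_zero).and
      (eventually_norm_coeff_alongLine_le G hGc (η := δ / 4) (by linarith)))).exists
  -- `A` has real part close to `D(t) W(N t)`, and unlike that function it is known to be analytic
  set A : C(Torus, ℂ) := g + (1 / 2 : ℂ) • ((g + star g) * dilate N q) with hA
  have hAapp (t) : A t = g t + (g t).re * q (N • t) := by
    simp only [hA, ContinuousMap.add_apply, ContinuousMap.smul_apply, ContinuousMap.mul_apply,
      ContinuousMap.star_apply, dilate_apply, smul_eq_mul, RCLike.star_def, Complex.add_conj]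
    push_cast
    ring
  have hAmem : A ∈ discAlgebra :=
    add_mem (analyticPoly_le_discAlgebra hS.mem) (Subalgebra.smul_mem _ hNmem _)
  have hAim : (coeffCLM 0 A).im = 0 := by
    rw [hA, map_add, map_smul, hNmean, smul_zero, add_zero, hS.im_mean]
  have hAG : expMap A - expMap g = alongLine N G := by
    ext t
    simp only [ContinuousMap.sub_apply, expMap_apply, hAapp, alongLine_apply, hG,
      ContinuousMap.coe_mk, Complex.exp_add]
    ring
  let D' : C(Torus, ℝ) := ⟨fun t => D t * W (N • t), by fun_prop⟩
  have hD' (t) : D' t = D t * W (N • t) := rfl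
  obtain ⟨g', hg', hg'im, hg'c⟩ := exists_analyticPoly_re_close D' hη'
  have hD'0 (t) : 0 ≤ D' t := mul_nonneg (hS.nonneg t) (hB.nonneg _)
  have hD'M (t) : D' t ≤ M * R := mul_le_mul (hS.le t) (hB.le _) (hB.nonneg _) hM
  have hAD (t) : |(A t).re - D' t| ≤ 2 * τ := by
    have h1 : (A t).re - D' t = ((g t).re - D t) * W (N • t)
        + (g t).re * (1 + (q (N • t)).re - W (N • t)) := by
      rw [hAapp, hD', Complex.add_re, Complex.re_ofReal_mul]; ring
    rw [h1]
    refine (abs_add_le _ _).trans ?_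
    rw [abs_mul, abs_mul, abs_of_nonneg (hB.nonneg (N • t))]
    have h2 := mul_le_mul (hS.close t) (hB.le (N • t)) (hB.nonneg _) hη0
    have h3 := mul_le_mul (hre t) (hB.close (N • t)) (abs_nonneg _) (by linarith)
    linarith
  have hcomp : ∫ t, ‖Complex.exp (g' t) - Complex.exp (A t)‖ ∂torusHaar ≤ δ / 2 := by
    refine (integral_norm_exp_sub_le (analyticPoly_le_discAlgebra hg') hAmem hg'im hAim
      (K := M * R + 1) (θ := 3 * τ) (fun t => ?_) (fun t => ?_) (fun t => ?_)).trans ?_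
    · linarith [(abs_le.1 (hg'c t)).2, hD'M t]
    · linarith [(abs_le.1 (hAD t)).2, hD'M t]
    · have h1 := abs_le.1 (hg'c t)
      have h2 := abs_le.1 (hAD t)
      rw [abs_le]
      constructor <;> linarith [h1.1, h1.2, h2.1, h2.2]
    · nlinarith
  have hpre : MeasurePreserving (fun t : Torus => N • t) torusHaar torusHaar := by
    have := Measure.measurePreserving_zsmul torusHaar (n := (N : ℤ)) (by exact_mod_cast hN0.ne')
    simpa only [natCast_zsmul] using this
  refine ⟨D', U ∪ (fun t => N • t) ⁻¹' E, g',
    ⟨hS.isOpen.union (hB.isOpen.preimage (continuous_nsmul N)), hD'0, hD'M, ?_, hg', hg'im, hg'c⟩,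
    Set.subset_union_left, ?_, fun n => ?_, ?_⟩
  · rintro t (ht | ht)
    · rw [hD', hS.eq_zero t ht, zero_mul]
    · rw [hD', hB.eq_zero _ ht, mul_zero]
  · refine le_trans ?_ hB.measure_compl
    have h1 : torusHaar.real ((fun t : Torus => N • t) ⁻¹' Eᶜ) = torusHaar.real Eᶜ :=
      hpre.measureReal_preimage hB.isOpen.measurableSet.compl.nullMeasurableSet
    rw [← h1]
    refine measureReal_mono ?_
    rw [Set.preimage_compl]
    exact Set.compl_subset_compl.2 Set.subset_union_right
  · have h1 : expMap g' - expMap g = (expMap g' - expMap A) + alongLine N G := by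
      rw [← hAG]; abel
    rw [h1, map_add]
    refine (norm_add_le _ _).trans ?_
    have h2 := hNG n
    have h3 : ‖coeffCLM n (expMap g' - expMap A)‖ ≤ δ / 2 :=
      (norm_fourierCoeff_le_integral _ _).trans hcomp
    linarith
  · have hint : ∀ f : C(Torus, ℂ), IntegrableOn (fun t => ‖f t‖) U torusHaar := fun f =>
      (integrable_continuousMap f).norm.integrableOn
    have h1 : ∫ t in U, ‖expMap g' t - expMap A t‖ ∂torusHaar ≤ δ / 2 :=
      (setIntegral_le_integral (integrable_continuousMap (expMap g' - expMap A)).norm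
        (Eventually.of_forall fun t => norm_nonneg _)).trans hcomp
    have hbd : ∀ t ∈ U, ‖expMap A t - expMap g t‖ ≤ δ / 2 := by
      intro t ht
      have hs := hS.close t
      rw [hS.eq_zero t ht, sub_zero] at hs
      have h2 : ‖((g t).re : ℂ) * q (N • t)‖ ≤ η * Q := by
        rw [norm_mul, Complex.norm_real, Real.norm_eq_abs]
        exact mul_le_mul hs (hB.norm_le _) (norm_nonneg _) hη0
      have h3 := Complex.norm_exp_sub_one_le (h2.trans (by linarith : η * Q ≤ 1))
      have h4 : expMap A t - expMap g t
          = Complex.exp (g t) * (Complex.exp ((g t).re * q (N • t)) - 1) := by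
        rw [expMap_apply, expMap_apply, hAapp, Complex.exp_add]; ring
      rw [h4, norm_mul, Complex.norm_exp]
      have h5 : Real.exp (g t).re ≤ 3 :=
        (Real.exp_le_exp.2 (((le_abs_self _).trans hs).trans (hη1.trans (by norm_num)))).trans
          (Real.exp_one_lt_d9.le.trans (by norm_num))
      calc _ ≤ 3 * (2 * (η * Q)) :=
            mul_le_mul h5 (h3.trans (by linarith)) (norm_nonneg _) (by norm_num)
        _ ≤ δ / 2 := by linarith
    have h6 : ∫ t in U, ‖expMap A t - expMap g t‖ ∂torusHaar ≤ δ / 2 := by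
      refine (setIntegral_mono_on (hint (expMap A - expMap g)) (integrableOn_const (by finiteness))
        hS.isOpen.measurableSet hbd).trans ?_
      rw [setIntegral_const, smul_eq_mul]
      have : torusHaar.real U ≤ 1 := measureReal_le_one
      nlinarith
    calc ∫ t in U, ‖expMap g' t - expMap g t‖ ∂torusHaar
        ≤ ∫ t in U, (‖expMap g' t - expMap A t‖ + ‖expMap A t - expMap g t‖) ∂torusHaar :=
          setIntegral_mono (hint (expMap g' - expMap g))
            ((hint (expMap g' - expMap A)).add (hint (expMap A - expMap g)))
            fun t => norm_sub_le_norm_sub_add_norm_sub _ _ _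
      _ ≤ δ := by
          have h7 := integral_add (hint (expMap g' - expMap A)) (hint (expMap A - expMap g))
          simp only [ContinuousMap.sub_apply] at h7
          rw [h7]
          linarith

/-! ### The sequence of outer functions -/

/-- A sequence of functions `F k` of the disc algebra, starting from the constant `e`, which changes
little in the sense of Fourier coefficients, and open sets `U k` of almost full measure on which
`F k` is bounded by `2` and changes little in mean. -/
structure IsOuterSequence (F : ℕ → C(Torus, ℂ)) (U : ℕ → Set Torus) : Prop where
  zero : F 0 = algebraMap ℂ _ (Complex.exp 1)
  mem : ∀ k, F k ∈ discAlgebra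
  isOpen : ∀ k, IsOpen (U k)
  mono : ∀ k, U k ⊆ U (k + 1)
  measure_compl : ∀ k, torusHaar.real (U (k + 1))ᶜ ≤ (1 / 2) ^ k
  norm_le : ∀ k, ∀ t ∈ U k, ‖F k t‖ ≤ 2
  coeff_le : ∀ k n, ‖coeffCLM n (F (k + 1) - F k)‖ ≤ (1 / 2) ^ (k + 2)
  integral_le : ∀ k, ∫ t in U k, ‖F (k + 1) t - F k t‖ ∂torusHaar ≤ (1 / 2) ^ (k + 2)

theorem exists_outerSequence : ∃ F U, IsOuterSequence F U := by
  -- The parameters are fixed in the order `R`, `M`, `y`, `Q`, `η`, `ε`; only the frequency `N` of each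
  -- step depends on the functions constructed before.
  choose R hR Q' hQ' using fun k : ℕ => exists_block (κ := (1 / 2 : ℝ) ^ k) (by positivity)
  set M : ℕ → ℝ := fun k => ∏ j ∈ Finset.range k, R j with hM
  have hMs (k) : M (k + 1) = M k * R k := Finset.prod_range_succ _ _
  have hM1 (k) : 1 ≤ M k := Finset.one_le_prod fun j _ => hR j
  set δ : ℕ → ℝ := fun k => (1 / 2 : ℝ) ^ (k + 2) with hδ
  have hδ0 (k) : 0 < δ k := by positivity
  have hδ1 (k) : δ k ≤ 1 := pow_le_one₀ (by norm_num) (by norm_num)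
  set τ : ℕ → ℝ := fun k => δ k * Real.exp (-(M k * R k + 1)) / 12 with hτ
  have hτ0 (k) : 0 < τ k := by have := hδ0 k; positivity
  have hτs (k) : τ (k + 1) ≤ τ k := by
    have h1 : δ (k + 1) ≤ δ k := pow_le_pow_of_le_one (by norm_num) (by norm_num) (by omega)
    have h2 : M k * R k ≤ M (k + 1) * R (k + 1) := by
      rw [← hMs]; exact le_mul_of_one_le_right (by linarith [hM1 (k + 1)]) (hR _)
    have h3 : Real.exp (-(M (k + 1) * R (k + 1) + 1)) ≤ Real.exp (-(M k * R k + 1)) :=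
      Real.exp_le_exp.2 (by linarith)
    have := mul_le_mul h1 h3 (Real.exp_pos _).le (hδ0 k).le
    simp only [hτ]; linarith
  set y : ℕ → ℝ := fun k => τ k / (M k + 1) with hy
  have hy0 (k) : 0 < y k := div_pos (hτ0 k) (by linarith [hM1 k])
  set Q : ℕ → ℝ := fun k => Q' k (y k) (hy0 k) with hQ
  have hQ0 (k) : 0 ≤ Q k := (hQ' k (y k) (hy0 k)).1
  set η : ℕ → ℝ := fun k => min (1 / 2) (min (τ k / R k) (δ k / (12 * (Q k + 1)))) with hη
  have hη0 (k) : 0 < η k := by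
    have := hδ0 k; have := hτ0 k; have := hQ0 k
    have := zero_lt_one.trans_le (hR k)
    positivity
  set ε : ℕ → ℝ := fun k => δ k / 4 / Real.exp (M k + 1) with hε
  have hε0 (k) : 0 < ε k := by have := hδ0 k; positivity
  choose W E q hB using fun k =>
    (hQ' k (y k) (hy0 k)).2 (M k + 1) (by linarith [hM1 k]) (ε k) (hε0 k)
  have hηR (k) : η k ≤ τ k / R k := (min_le_right _ _).trans (min_le_left _ _)
  have step (k : ℕ) (s : {s : C(Torus, ℝ) × Set Torus × C(Torus, ℂ) //
      IsStage (M k) (η k) s.1 s.2.1 s.2.2}) :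
      ∃ s' : {s : C(Torus, ℝ) × Set Torus × C(Torus, ℂ) //
        IsStage (M (k + 1)) (η (k + 1)) s.1 s.2.1 s.2.2},
        s.1.2.1 ⊆ s'.1.2.1 ∧ torusHaar.real s'.1.2.1ᶜ ≤ (1 / 2) ^ k ∧
        (∀ n, ‖coeffCLM n (expMap s'.1.2.2 - expMap s.1.2.2)‖ ≤ δ k) ∧
        ∫ t in s.1.2.1, ‖expMap s'.1.2.2 t - expMap s.1.2.2 t‖ ∂torusHaar ≤ δ k := by
    have hR0 : 0 < R k := zero_lt_one.trans_le (hR k)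
    have hQ1 : 0 < 12 * (Q k + 1) := by linarith [hQ0 k]
    obtain ⟨D', U', g', hS', h⟩ := exists_next_stage (by linarith [hM1 k]) (hR k)
      (hη0 (k + 1)) (min_le_left _ _) (hδ0 k) (hδ1 k)
      (by have := hηR k; rwa [le_div_iff₀ hR0] at this)
      (((hηR (k + 1)).trans (div_le_self (hτ0 _).le (hR _))).trans (hτs k))
      (by
        have : M k + 1 ≠ 0 := by linarith [hM1 k]
        rw [hy]; exact (mul_div_cancel₀ _ this).le)
      (by
        have : η k ≤ δ k / (12 * (Q k + 1)) := (min_le_right _ _).trans (min_le_right _ _)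
        rw [le_div_iff₀ hQ1] at this
        nlinarith [hη0 k])
      (by rw [hε]; exact (div_mul_cancel₀ _ (Real.exp_pos _).ne').le)
      s.2 (hB k)
    exact ⟨⟨(D', U', g'), by rw [hMs]; exact hS'⟩, h⟩
  choose next hnext using step
  have h0 : IsStage (M 0) (η 0) (1 : C(Torus, ℝ)) ∅ (1 : C(Torus, ℂ)) :=
    ⟨isOpen_empty, fun _ => zero_le_one, fun _ => hM1 0, by simp, one_mem _,
      by rw [coeffCLM_one]; simp, fun t => by simpa using (hη0 0).le⟩
  let seq : ∀ k, {s : C(Torus, ℝ) × Set Torus × C(Torus, ℂ) //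
      IsStage (M k) (η k) s.1 s.2.1 s.2.2} :=
    fun k => Nat.rec ⟨(1, ∅, 1), h0⟩ (fun k s => next k s) k
  refine ⟨fun k => expMap (seq k).1.2.2, fun k => (seq k).1.2.1, ?_, fun k => ?_, fun k => ?_,
    fun k => (hnext k (seq k)).1, fun k => (hnext k (seq k)).2.1, fun k t ht => ?_,
    fun k => (hnext k (seq k)).2.2.1, fun k => (hnext k (seq k)).2.2.2⟩
  · ext t
    change Complex.exp 1 = _
    simp [Algebra.algebraMap_eq_smul_one]
  · exact expMap_mem (analyticPoly_le_discAlgebra (seq k).2.mem)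
  · exact (seq k).2.isOpen
  · have h1 := (seq k).2.close t
    rw [(seq k).2.eq_zero t ht, sub_zero] at h1
    have h2 : ((seq k).1.2.2 t).re ≤ 1 / 2 := ((le_abs_self _).trans h1).trans (min_le_left _ _)
    rw [expMap_apply, Complex.norm_exp]
    refine (Real.exp_le_exp.2 h2).trans ?_
    have h3 : Real.exp (1 / 2) * Real.exp (1 / 2) = Real.exp 1 := by
      rw [← Real.exp_add]; norm_num
    nlinarith [Real.exp_one_lt_d9, Real.exp_pos (1 / 2)]

/-! ### Localisation for series with coefficients tending to zero -/

theorem sum_Icc_shift (g : ℤ → ℂ) (N : ℕ) :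
    ∑ n ∈ Finset.Icc (-(N : ℤ)) N, g (n - 1)
      = ∑ n ∈ Finset.Icc (-(N : ℤ)) N, g n + g (-N - 1) - g N := by
  induction N with
  | zero => simp
  | succ N ih =>
    have h : Finset.Icc (-((N + 1 : ℕ) : ℤ)) ((N + 1 : ℕ) : ℤ)
        = insert (-((N : ℤ) + 1)) (insert ((N : ℤ) + 1) (Finset.Icc (-(N : ℤ)) N)) := by
      ext x; simp only [Finset.mem_insert, Finset.mem_Icc]; push_cast; omega
    rw [h, Finset.sum_insert (by simp; omega), Finset.sum_insert (by simp),
      Finset.sum_insert (by simp; omega), Finset.sum_insert (by simp), ih]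
    push_cast
    rw [show (N : ℤ) + 1 - 1 = N by ring, show -(N : ℤ) - 1 = -(N + 1) by ring]
    ring

/-- Shifting the window of a symmetric partial sum changes it by boundary terms only. -/
theorem shifted_sum_bound {a : ℤ → ℂ} {C : ℝ} (hC : ∀ n, ‖a n‖ ≤ C)
    (ha : Tendsto a cofinite (𝓝 0)) (l : ℤ) :
    (∀ N : ℕ, ‖∑ n ∈ Finset.Icc (-(N : ℤ)) N, a n
      - ∑ n ∈ Finset.Icc (-(N : ℤ)) N, a (n - l)‖ ≤ 2 * C * |(l : ℝ)|) ∧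
    Tendsto (fun N : ℕ => ∑ n ∈ Finset.Icc (-(N : ℤ)) N, a n
      - ∑ n ∈ Finset.Icc (-(N : ℤ)) N, a (n - l)) atTop (𝓝 0) := by
  set A : ℤ → ℕ → ℂ := fun l N => ∑ n ∈ Finset.Icc (-(N : ℤ)) N, a (n - l) with hA
  have hstep (l : ℤ) (N : ℕ) : A (l + 1) N = A l N + a (-N - 1 - l) - a (N - l) := by
    have := sum_Icc_shift (fun n => a (n - l)) N
    simp only [hA, ← this]
    exact Finset.sum_congr rfl fun n _ => by ring_nf
  have ht (f : ℕ → ℤ) (hf : Function.Injective f) : Tendsto (fun N => a (f N)) atTop (𝓝 0) := by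
    rw [← Nat.cofinite_eq_atTop]
    exact ha.comp hf.tendsto_cofinite
  have ht1 (l : ℤ) : Tendsto (fun N : ℕ => a (-N - 1 - l)) atTop (𝓝 0) :=
    ht _ fun x y h => by simpa using h
  have ht2 (l : ℤ) : Tendsto (fun N : ℕ => a (N - l)) atTop (𝓝 0) :=
    ht _ fun x y h => by simpa using h
  have h0 (N : ℕ) : ∑ n ∈ Finset.Icc (-(N : ℤ)) N, a n = A 0 N := by simp [hA]
  simp_rw [h0]
  change (∀ N, ‖A 0 N - A l N‖ ≤ _) ∧ Tendsto (fun N => A 0 N - A l N) atTop (𝓝 0)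
  induction l using Int.induction_on with
  | zero => simp
  | succ i ih =>
    have e (N) : A 0 N - A (i + 1) N = (A 0 N - A i N) - a (-N - 1 - i) + a (N - i) := by
      rw [hstep]; ring
    simp_rw [e]
    refine ⟨fun N => ?_, by simpa using (ih.2.sub (ht1 i)).add (ht2 i)⟩
    have h1 := norm_add_le (A 0 N - A i N - a (-N - 1 - i)) (a (N - i))
    have h2 := norm_sub_le (A 0 N - A i N) (a (-N - 1 - i))
    have h3 := ih.1 N
    have h4 : |(((i : ℤ) + 1 : ℤ) : ℝ)| = |((i : ℤ) : ℝ)| + 1 := by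
      push_cast; rw [abs_of_nonneg (by positivity), abs_of_nonneg (by positivity)]
    rw [h4]
    linarith [hC (-N - 1 - i), hC (N - i)]
  | pred i ih =>
    have e (N) : A 0 N - A (-i - 1) N
        = (A 0 N - A (-i) N) + a (-N - 1 - (-i - 1)) - a (N - (-i - 1)) := by
      have := hstep (-i - 1) N
      rw [sub_add_cancel] at this
      rw [this]; ring
    simp_rw [e]
    refine ⟨fun N => ?_, by simpa using (ih.2.add (ht1 (-i - 1))).sub (ht2 (-i - 1))⟩
    have h1 := norm_sub_le (A 0 N - A (-i) N + a (-N - 1 - (-i - 1))) (a (N - (-i - 1)))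
    have h2 := norm_add_le (A 0 N - A (-i) N) (a (-N - 1 - (-i - 1)))
    have h3 := ih.1 N
    have h4 : |((-(i : ℤ) - 1 : ℤ) : ℝ)| = |((-(i : ℤ) : ℤ) : ℝ)| + 1 := by
      push_cast
      rw [abs_of_nonpos (by linarith [(Nat.cast_nonneg i : (0 : ℝ) ≤ i)]),
        abs_of_nonpos (by linarith [(Nat.cast_nonneg i : (0 : ℝ) ≤ i)])]
      ring
    rw [h4]
    linarith [hC (-N - 1 - (-i - 1)), hC (N - (-i - 1))]

/-- **Rajchman's localisation.** If the formal product of a trigonometric series with coefficients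
tending to zero and a smooth function `ψ` vanishes, then the series converges to zero wherever
`ψ` is nonzero. -/
theorem tendsto_trigPartialSum_of_convolution_eq_zero {c b : ℤ → ℂ} {C : ℝ} (hC : ∀ n, ‖c n‖ ≤ C)
    (hc : Tendsto c cofinite (𝓝 0)) (hb : Summable fun l : ℤ => (1 + |(l : ℝ)|) * ‖b l‖)
    (hconv : ∀ n, ∑' l, b l * c (n - l) = 0) {t : Torus} (ht : ∑' l, b l * fourier l t ≠ 0) :
    Tendsto (fun N => trigPartialSum c N t) atTop (𝓝 0) := by
  have hC0 : 0 ≤ C := (norm_nonneg _).trans (hC 0)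
  have hb1 : Summable fun l => ‖b l‖ :=
    hb.of_nonneg_of_le (fun l => norm_nonneg _) fun l =>
      le_mul_of_one_le_left (norm_nonneg _) (by linarith [abs_nonneg (l : ℝ)])
  have hb2 : Summable fun l : ℤ => ‖b l‖ * (2 * C * |(l : ℝ)|) := by
    refine (hb.mul_left (2 * C)).of_nonneg_of_le (fun l => by positivity) fun l => ?_
    have := mul_nonneg hC0 (norm_nonneg (b l))
    nlinarith
  set a : ℤ → ℂ := fun n => c n * fourier n t with ha
  have hna (n) : ‖a n‖ = ‖c n‖ := by rw [ha]; simp only [norm_mul, norm_fourier_apply, mul_one]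
  have haC (n) : ‖a n‖ ≤ C := (hna n).le.trans (hC n)
  have ha0 : Tendsto a cofinite (𝓝 0) := by
    rw [tendsto_zero_iff_norm_tendsto_zero] at hc ⊢
    simpa only [hna] using hc
  set Δ : ℤ → ℕ → ℂ := fun l N => ∑ n ∈ Finset.Icc (-(N : ℤ)) N, a n
      - ∑ n ∈ Finset.Icc (-(N : ℤ)) N, a (n - l) with hΔ
  have hlim : Tendsto (fun N => ∑' l, b l * fourier l t * Δ l N) atTop (𝓝 0) := by
    have := tendsto_tsum_of_dominated_convergence (f := fun N l => b l * fourier l t * Δ l N)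
      (g := fun _ => (0 : ℂ)) (𝓕 := atTop) hb2
      (fun l => by
        have := (shifted_sum_bound haC ha0 l).2.const_mul (b l * fourier l t)
        rwa [mul_zero] at this)
      (Eventually.of_forall fun N l => by
        rw [norm_mul, norm_mul, norm_fourier_apply, mul_one]
        exact mul_le_mul_of_nonneg_left ((shifted_sum_bound haC ha0 l).1 N) (norm_nonneg _))
    simpa using this
  have hbf : Summable fun l => b l * fourier l t :=
    Summable.of_norm (by simpa only [norm_mul, norm_fourier_apply, mul_one] using hb1)
  have hbc (n : ℤ) : Summable fun l => b l * c (n - l) :=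
    Summable.of_norm_bounded (hb1.mul_right C) fun l => by
      rw [norm_mul]; exact mul_le_mul_of_nonneg_left (hC _) (norm_nonneg _)
  have hsum (N : ℕ) : ∑' l, b l * fourier l t * Δ l N
      = (∑' l, b l * fourier l t) * trigPartialSum c N t := by
    have h1 (l : ℤ) : b l * fourier l t * Δ l N = b l * fourier l t * trigPartialSum c N t
        - ∑ n ∈ Finset.Icc (-(N : ℤ)) N, fourier n t * (b l * c (n - l)) := by
      rw [hΔ]
      simp only [mul_sub, ha]
      congr 1
      rw [Finset.mul_sum]
      refine Finset.sum_congr rfl fun n _ => ?_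
      have : fourier n t = fourier l t * fourier (n - l) t := by
        rw [← fourier_add]; congr 2; ring
      rw [this]; ring
    simp_rw [h1]
    rw [Summable.tsum_sub (hbf.mul_right _) (summable_sum fun n _ => (hbc n).mul_left _),
      Summable.tsum_finsetSum (fun n _ => (hbc n).mul_left _), tsum_mul_right]
    simp_rw [tsum_mul_left, hconv, mul_zero, Finset.sum_const_zero, sub_zero]
  simp_rw [hsum] at hlim
  have := hlim.const_mul (∑' l, b l * fourier l t)⁻¹
  simpa only [inv_mul_cancel_left₀ ht, mul_zero] using this

/-- If `ψ h = 0` then the convolution of the Fourier coefficients of `ψ` and `h` vanishes. -/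
theorem tsum_fourierCoeff_mul_eq_zero {ψ : C(Torus, ℂ)} (hψ : Summable (fourierCoeff ψ))
    {h : Torus → ℂ} (hh : Integrable h torusHaar) (h0 : ∀ t, ψ t * h t = 0) (n : ℤ) :
    ∑' l, fourierCoeff ψ l * fourierCoeff h (n - l) = 0 := by
  have h1 (l : ℤ) : fourierCoeff ψ l * fourierCoeff h (n - l)
      = ∫ t, fourierCoeff ψ l * (fourier (-(n - l)) t * h t) ∂torusHaar := by
    rw [integral_const_mul]; rfl
  have hi (l : ℤ) : Integrable (fun t => fourierCoeff ψ l * (fourier (-(n - l)) t * h t))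
      torusHaar := (hh.fourier_smul _).const_mul _
  simp_rw [h1]
  rw [integral_tsum_of_summable_integral_norm hi]
  · refine integral_eq_zero_of_ae (Eventually.of_forall fun t => ?_)
    have h2 := (has_pointwise_sum_fourier_series_of_summable hψ t).mul_right (fourier (-n) t * h t)
    have h3 (l : ℤ) : fourierCoeff ψ l * (fourier (-(n - l)) t * h t)
        = fourierCoeff ψ l • fourier l t * (fourier (-n) t * h t) := by
      rw [show -(n - l) = l + -n by ring, fourier_add, smul_eq_mul]; ring
    simp only [h3, h2.tsum_eq, Pi.zero_apply]
    rw [mul_left_comm, h0, mul_zero]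
  · have h2 (l : ℤ) : ∫ t, ‖fourierCoeff ψ l * (fourier (-(n - l)) t * h t)‖ ∂torusHaar
        = ‖fourierCoeff ψ l‖ * ∫ t, ‖h t‖ ∂torusHaar := by
      simp only [norm_mul, norm_fourier_apply, one_mul]
      rw [integral_const_mul]
    simp_rw [h2]
    exact hψ.norm.mul_right _

theorem integral_deriv_mul_exp {h : ℝ → ℂ} (hd : ContDiff ℝ 1 h)
    (hp : Function.Periodic h (2 * Real.pi)) (n : ℤ) :
    ∫ x in (0 : ℝ)..2 * Real.pi, Complex.exp (-(n * x * Complex.I)) * deriv h x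
      = n * Complex.I * ∫ x in (0 : ℝ)..2 * Real.pi, Complex.exp (-(n * x * Complex.I)) * h x := by
  have hc' : Continuous (deriv h) := hd.continuous_deriv le_rfl
  have hc : Continuous h := hd.continuous
  have hder (x : ℝ) : HasDerivAt (fun x : ℝ => Complex.exp (-(n * x * Complex.I)) * h x)
      (Complex.exp (-(n * x * Complex.I)) * deriv h x
        - n * Complex.I * (Complex.exp (-(n * x * Complex.I)) * h x)) x := by
    have h1 : HasDerivAt (fun x : ℝ => -((n : ℂ) * x * Complex.I)) (-(n * 1 * Complex.I)) x :=
      (((Complex.ofRealCLM.hasDerivAt (x := x)).const_mul (n : ℂ)).mul_const Complex.I).neg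
    have h2 := h1.cexp.mul ((hd.differentiable one_ne_zero) x).hasDerivAt
    exact h2.congr_deriv (by ring)
  have hi := intervalIntegral.integral_eq_sub_of_hasDerivAt (a := 0) (b := 2 * Real.pi)
    (fun x _ => hder x) (Continuous.intervalIntegrable (by fun_prop) _ _)
  rw [intervalIntegral.integral_sub (Continuous.intervalIntegrable (by fun_prop) _ _)
    (Continuous.intervalIntegrable (by fun_prop) _ _), intervalIntegral.integral_const_mul] at hi
  have h0 : h (2 * Real.pi) = h 0 := by simpa using hp 0
  have he : Complex.exp (-(n * ((2 * Real.pi : ℝ) : ℂ) * Complex.I)) = 1 := by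
    rw [Complex.exp_eq_one_iff]
    exact ⟨-n, by push_cast; ring⟩
  rw [h0, he] at hi
  simp only [Complex.ofReal_zero, mul_zero, zero_mul, neg_zero, Complex.exp_zero, sub_self] at hi
  exact sub_eq_zero.1 hi

theorem exists_pow_mul_integral_exp_le (k : ℕ) {h : ℝ → ℂ} (hd : ContDiff ℝ k h)
    (hp : Function.Periodic h (2 * Real.pi)) :
    ∃ C, ∀ n : ℤ, |(n : ℝ)| ^ k *
      ‖∫ x in (0 : ℝ)..2 * Real.pi, Complex.exp (-(n * x * Complex.I)) * h x‖ ≤ C := by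
  induction k generalizing h with
  | zero =>
    refine ⟨∫ x in (0 : ℝ)..2 * Real.pi, ‖h x‖, fun n => ?_⟩
    rw [pow_zero, one_mul]
    refine (intervalIntegral.norm_integral_le_integral_norm Real.two_pi_pos.le).trans (le_of_eq ?_)
    refine intervalIntegral.integral_congr fun x _ => ?_
    have : -((n : ℂ) * x * Complex.I) = ((-(n * x) : ℝ) : ℂ) * Complex.I := by push_cast; ring
    simp only [norm_mul, this, Complex.norm_exp_ofReal_mul_I, one_mul]
  | succ k ih =>
    have hd1 : ContDiff ℝ k (deriv h) := by
      have : ContDiff ℝ (k + 1) h := by exact_mod_cast hd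
      exact (contDiff_succ_iff_deriv.1 this).2.2
    have hp1 : Function.Periodic (deriv h) (2 * Real.pi) := fun x => by
      rw [← deriv_comp_add_const]
      exact congrArg (fun f => deriv f x) (funext hp)
    obtain ⟨C, hC⟩ := ih hd1 hp1
    refine ⟨C, fun n => ?_⟩
    have h1 := hC n
    rw [integral_deriv_mul_exp (hd.of_le (by exact_mod_cast Nat.le_add_left 1 k)) hp,
      norm_mul, norm_mul, Complex.norm_I, mul_one, Complex.norm_intCast] at h1
    rw [pow_succ, mul_assoc]
    exact h1

/-- Smooth bump functions: the Fourier coefficients are summable against the frequency. -/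
theorem exists_bump {U : Set Torus} (hU : IsOpen U) {t₀ : Torus} (ht₀ : t₀ ∈ U) :
    ∃ ψ : C(Torus, ℂ), ψ t₀ ≠ 0 ∧ (∀ t ∉ U, ψ t = 0) ∧
      Summable fun l : ℤ => (1 + |(l : ℝ)|) * ‖fourierCoeff ψ l‖ := by
  -- by compactness `cos (t - t₀)` stays away from `1` off `U`
  obtain ⟨r, hr1, hr⟩ : ∃ r < (1 : ℝ), ∀ t ∉ U, (fourier 1 (t - t₀)).re ≤ r := by
    by_cases hne : (Uᶜ).Nonempty
    · obtain ⟨s, hs, hmax⟩ := hU.isClosed_compl.isCompact.exists_isMaxOn hne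
        (f := fun t => (fourier 1 (t - t₀)).re) (by fun_prop)
      refine ⟨_, lt_of_le_of_ne ?_ fun h => ?_, fun t ht => hmax ht⟩
      · exact (Complex.re_le_norm _).trans (norm_fourier_apply _ _).le
      · have h1 : fourier 1 (s - t₀) = fourier 1 (0 : Torus) := by
          rw [fourier_eval_zero]
          replace h : (fourier 1 (s - t₀)).re = 1 := h
          have h2 := Complex.sq_norm (fourier 1 (s - t₀))
          rw [norm_fourier_apply, Complex.normSq_apply, h] at h2
          exact Complex.ext (by simpa using h) (by simp only [Complex.one_im]; nlinarith)
        rw [fourier_one, fourier_one] at h1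
        have h3 := injective_toCircle (T := 2 * Real.pi) Real.two_pi_pos.ne'
          (Subtype.coe_injective h1)
        rw [sub_eq_zero.1 h3] at hs
        exact hs ht₀
    · refine ⟨0, one_pos, fun t ht => (hne ⟨t, ht⟩).elim⟩
  have hglue : Continuous expNegInvGlue := expNegInvGlue.contDiff (n := 0) |>.continuous
  let ψ : C(Torus, ℂ) := ⟨fun t => (expNegInvGlue ((fourier 1 (t - t₀)).re - r) : ℂ), by fun_prop⟩
  have hψ (t) : ψ t = (expNegInvGlue ((fourier 1 (t - t₀)).re - r) : ℂ) := rfl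
  refine ⟨ψ, ?_, fun t ht => ?_, ?_⟩
  · rw [hψ, sub_self, fourier_eval_zero, Complex.one_re, Complex.ofReal_ne_zero]
    exact (expNegInvGlue.pos_of_pos (by linarith)).ne'
  · rw [hψ, expNegInvGlue.zero_of_nonpos (by linarith [hr t ht]), Complex.ofReal_zero]
  · set h : ℝ → ℂ := fun x => ψ x with hh
    obtain ⟨x₀, rfl⟩ := QuotientAddGroup.mk_surjective t₀
    have hhx : h = fun x => ((expNegInvGlue (Real.cos (x - x₀) - r) : ℝ) : ℂ) := by
      funext x
      rw [hh]
      simp only [hψ]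
      congr 3
      have : ((x : Torus) - (QuotientAddGroup.mk x₀ : Torus)) = ((x - x₀ : ℝ) : Torus) := rfl
      rw [this, fourier_coe_apply]
      have : 2 * (Real.pi : ℂ) * Complex.I * (1 : ℤ) * ((x - x₀ : ℝ) : ℂ) / ((2 * Real.pi : ℝ) : ℂ)
          = ((x - x₀ : ℝ) : ℂ) * Complex.I := by
        have : (Real.pi : ℂ) ≠ 0 := Complex.ofReal_ne_zero.2 Real.pi_ne_zero
        push_cast
        field_simp
      rw [this, Complex.exp_ofReal_mul_I_re]
    have hcd : ContDiff ℝ (3 : ℕ) h := by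
      rw [hhx]
      exact Complex.ofRealCLM.contDiff.comp (expNegInvGlue.contDiff.comp
        ((Real.contDiff_cos.comp (contDiff_id.sub contDiff_const)).sub contDiff_const))
    have hper : Function.Periodic h (2 * Real.pi) := fun x => by
      rw [hhx]
      simp only
      rw [show x + 2 * Real.pi - x₀ = x - x₀ + 2 * Real.pi by ring, Real.cos_add_two_pi]
    obtain ⟨C, hC⟩ := exists_pow_mul_integral_exp_le 3 hcd hper
    have hco (n : ℤ) : fourierCoeff ψ n = (1 / (2 * Real.pi)) •
        ∫ x in (0 : ℝ)..2 * Real.pi, Complex.exp (-(n * x * Complex.I)) * h x := by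
      rw [fourierCoeff_eq_intervalIntegral _ n 0, zero_add]
      congr 1
      refine intervalIntegral.integral_congr fun x _ => ?_
      simp only [smul_eq_mul]
      rw [fourier_coe_apply]
      congr 2
      have : (Real.pi : ℂ) ≠ 0 := Complex.ofReal_ne_zero.2 Real.pi_ne_zero
      push_cast
      field_simp
    have hbound (n : ℤ) (hn : n ≠ 0) :
        (1 + |(n : ℝ)|) * ‖fourierCoeff ψ n‖ ≤ 2 * C * (1 / (n : ℝ) ^ 2) := by
      have hn1 : 1 ≤ |(n : ℝ)| := by exact_mod_cast Int.one_le_abs hn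
      have h1 : ‖fourierCoeff ψ n‖
          ≤ ‖∫ x in (0 : ℝ)..2 * Real.pi, Complex.exp (-(n * x * Complex.I)) * h x‖ := by
        rw [hco, norm_smul]
        refine mul_le_of_le_one_left (norm_nonneg _) ?_
        rw [Real.norm_eq_abs, abs_of_pos (by positivity), div_le_one Real.two_pi_pos]
        linarith [Real.pi_gt_three]
      have h2 := hC n
      rw [← sq_abs, mul_one_div, le_div_iff₀ (by positivity)]
      have h3 := norm_nonneg (fourierCoeff ψ n)
      have h4 : |(n : ℝ)| ^ 3 * ‖fourierCoeff ψ n‖ ≤ C :=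
        (mul_le_mul_of_nonneg_left h1 (by positivity)).trans h2
      have h5 : (1 + |(n : ℝ)|) * ‖fourierCoeff ψ n‖ * |(n : ℝ)| ^ 2
          ≤ 2 * |(n : ℝ)| * ‖fourierCoeff ψ n‖ * |(n : ℝ)| ^ 2 := by
        gcongr; linarith
      linarith
    have hsum : Summable fun n : ℤ => 2 * C * (1 / (n : ℝ) ^ 2) :=
      (Real.summable_one_div_int_pow.2 one_lt_two).mul_left _
    refine Summable.of_norm_bounded_eventually hsum ?_
    filter_upwards [(Set.finite_singleton (0 : ℤ)).compl_mem_cofinite] with n hn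
    rw [Real.norm_of_nonneg (by positivity)]
    exact hbound n hn

/-! ### The null series -/

/-- The `n`-th Fourier coefficient of `F m` restricted to the complement of `U m`. -/
noncomputable def complCoeff (F : ℕ → C(Torus, ℂ)) (U : ℕ → Set Torus) (m : ℕ) (n : ℤ) : ℂ :=
  fourierCoeff ((U m)ᶜ.indicator (F m)) n

namespace IsOuterSequence

variable {F : ℕ → C(Torus, ℂ)} {U : ℕ → Set Torus}

theorem monotone (h : IsOuterSequence F U) : Monotone U := monotone_nat_of_le_succ h.mono

theorem measurableSet (h : IsOuterSequence F U) (m : ℕ) : MeasurableSet (U m) :=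
  (h.isOpen m).measurableSet

theorem measure_compl_le (h : IsOuterSequence F U) (m : ℕ) :
    torusHaar.real (U m)ᶜ ≤ 2 * (1 / 2) ^ m := by
  cases m with
  | zero => exact measureReal_le_one.trans (by norm_num)
  | succ m => exact (h.measure_compl m).trans (by rw [pow_succ]; linarith)

theorem integrable_indicator_compl (h : IsOuterSequence F U) (m : ℕ) :
    Integrable ((U m)ᶜ.indicator (F m)) torusHaar :=
  (integrable_continuousMap (F m)).indicator (h.measurableSet m).compl

theorem integrable_indicator (h : IsOuterSequence F U) (m : ℕ) :
    Integrable ((U m).indicator (F m)) torusHaar :=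
  (integrable_continuousMap (F m)).indicator (h.measurableSet m)

theorem complCoeff_eq_sub (h : IsOuterSequence F U) (m : ℕ) (n : ℤ) :
    complCoeff F U m n = coeffCLM n (F m) - fourierCoeff ((U m).indicator (F m)) n := by
  rw [coeffCLM_apply, ← fourierCoeff_sub_of_integrable (integrable_continuousMap (F m))
    (h.integrable_indicator m)]
  have : (fun t => F m t - (U m).indicator (F m) t) = (U m)ᶜ.indicator (F m) := by
    rw [Set.indicator_compl]; rfl
  rw [this, complCoeff]

theorem norm_indicator_le (h : IsOuterSequence F U) (m : ℕ) (t : Torus) :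
    ‖(U m).indicator (F m) t‖ ≤ 2 := by
  by_cases ht : t ∈ U m
  · rw [Set.indicator_of_mem ht]; exact h.norm_le m t ht
  · rw [Set.indicator_of_notMem ht, norm_zero]; exact zero_le_two

/-- The restricted functions `1_{U m} F m` form a Cauchy sequence in `L¹`. -/
theorem integral_indicator_sub_le (h : IsOuterSequence F U) (m : ℕ) :
    ∫ t, ‖(U (m + 1)).indicator (F (m + 1)) t - (U m).indicator (F m) t‖ ∂torusHaar
      ≤ (1 / 2) ^ (m + 2) + 4 * (1 / 2) ^ m := by
  have hd : Integrable (fun t => ‖F (m + 1) t - F m t‖) torusHaar :=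
    (integrable_continuousMap (F (m + 1) - F m)).norm
  have hpt (t) : ‖(U (m + 1)).indicator (F (m + 1)) t - (U m).indicator (F m) t‖
      ≤ (U m).indicator (fun t => ‖F (m + 1) t - F m t‖) t
        + (U m)ᶜ.indicator (fun _ => (2 : ℝ)) t := by
    by_cases ht : t ∈ U m
    · simp [ht, h.mono m ht]
    · have := h.norm_indicator_le (m + 1) t
      simpa [ht] using this
  refine (integral_mono ((h.integrable_indicator _).sub (h.integrable_indicator _)).norm
    ((hd.indicator (h.measurableSet m)).add
      ((integrable_const (2 : ℝ)).indicator (h.measurableSet m).compl)) hpt).trans ?_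
  have e := integral_add (hd.indicator (h.measurableSet m))
      ((integrable_const (2 : ℝ)).indicator (h.measurableSet m).compl)
  rw [integral_indicator (h.measurableSet m), integral_indicator (h.measurableSet m).compl,
    setIntegral_const, smul_eq_mul] at e
  simp only [Pi.add_apply] at e ⊢
  rw [e]
  linarith [h.integral_le m, h.measure_compl_le m]

theorem dist_complCoeff_succ_le (h : IsOuterSequence F U) (n : ℤ) (m : ℕ) :
    dist (complCoeff F U m n) (complCoeff F U (m + 1) n) ≤ 5 * (1 / 2) ^ m := by
  rw [dist_comm, dist_eq_norm, h.complCoeff_eq_sub, h.complCoeff_eq_sub]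
  have e : coeffCLM n (F (m + 1)) - fourierCoeff ((U (m + 1)).indicator (F (m + 1))) n
      - (coeffCLM n (F m) - fourierCoeff ((U m).indicator (F m)) n)
      = coeffCLM n (F (m + 1) - F m)
        - fourierCoeff (fun t => (U (m + 1)).indicator (F (m + 1)) t - (U m).indicator (F m) t) n := by
    rw [fourierCoeff_sub_of_integrable (h.integrable_indicator _) (h.integrable_indicator _),
      map_sub]
    ring
  rw [e]
  refine (norm_sub_le _ _).trans ?_
  have h1 := h.coeff_le m n
  have h2 := (norm_fourierCoeff_le_integral (fun t => (U (m + 1)).indicator (F (m + 1)) t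
    - (U m).indicator (F m) t) n).trans (h.integral_indicator_sub_le m)
  have h3 : (1 / 2 : ℝ) ^ (m + 2) = (1 / 2) ^ m / 4 := by rw [pow_add]; norm_num; ring
  rw [h3] at h1 h2
  have : (0 : ℝ) < (1 / 2) ^ m := by positivity
  linarith

/-- The coefficients of the null series: the limits, uniform in `n`, of the Fourier coefficients of
`F m` restricted to the complement of `U m`. -/
theorem exists_limit (h : IsOuterSequence F U) :
    ∃ c : ℤ → ℂ, (∀ n, Tendsto (fun m => complCoeff F U m n) atTop (𝓝 (c n))) ∧
      ∀ m n, ‖complCoeff F U m n - c n‖ ≤ 10 * (1 / 2) ^ m := by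
  have hr : (1 / 2 : ℝ) < 1 := by norm_num
  choose c hc using fun n => cauchySeq_tendsto_of_complete
    (cauchySeq_of_le_geometric _ _ hr (h.dist_complCoeff_succ_le n))
  refine ⟨c, hc, fun m n => ?_⟩
  have := dist_le_of_le_geometric_of_tendsto _ _ hr (h.dist_complCoeff_succ_le n) (hc n) m
  rw [dist_eq_norm] at this
  refine this.trans (le_of_eq ?_)
  norm_num; ring

theorem memLp_indicator (h : IsOuterSequence F U) (m : ℕ) :
    MemLp ((U m).indicator (F m)) 2 torusHaar :=
  (memLp_continuousMap (F m)).indicator (h.measurableSet m)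

theorem tendsto_complCoeff_cofinite (h : IsOuterSequence F U) (m : ℕ) :
    Tendsto (complCoeff F U m) cofinite (𝓝 0) := by
  have h1 := (hasSum_sq_fourierCoeff_of_memLp
    ((memLp_continuousMap (F m)).indicator (h.measurableSet m).compl)).summable
  have h2 := (h1.tendsto_cofinite_zero).sqrt
  simp only [Real.sqrt_sq (norm_nonneg _), Real.sqrt_zero] at h2
  exact tendsto_zero_iff_norm_tendsto_zero.2 h2

theorem norm_coeff_zero_ge (h : IsOuterSequence F U) (m : ℕ) :
    Real.exp 1 - 1 / 2 + (1 / 2) ^ (m + 1) ≤ ‖coeffCLM 0 (F m)‖ := by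
  induction m with
  | zero =>
    rw [h.zero, Algebra.algebraMap_eq_smul_one, map_smul, coeffCLM_one, if_pos rfl, smul_eq_mul,
      mul_one, Complex.norm_exp, Complex.one_re]
    norm_num
  | succ m ih =>
    have h1 := h.coeff_le m 0
    have h2 : coeffCLM 0 (F m) = coeffCLM 0 (F (m + 1)) - coeffCLM 0 (F (m + 1) - F m) := by
      rw [map_sub]; ring
    rw [h2] at ih
    have h3 := ih.trans (norm_sub_le _ _)
    have h4 : (1 / 2 : ℝ) ^ (m + 1) = 2 * (1 / 2) ^ (m + 2) := by rw [pow_succ _ (m + 1)]; ring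
    rw [h4] at h3
    rw [show m + 1 + 1 = m + 2 by ring]
    linarith

end IsOuterSequence

theorem theorem1 :
    ∃ c : ℤ → ℂ, IsNullSeries c ∧ Summable (fun n : {n : ℤ // n < 0} => ‖c n‖ ^ 2) := by
  obtain ⟨F, U, h⟩ := exists_outerSequence
  obtain ⟨c, hc, hunif⟩ := h.exists_limit
  have hc0 : Tendsto c cofinite (𝓝 0) := by
    rw [tendsto_zero_iff_norm_tendsto_zero]
    refine Metric.tendsto_nhds.2 fun ε hε => ?_
    obtain ⟨m, hm⟩ := exists_pow_lt_of_lt_one (show 0 < ε / 20 by positivity)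
      (show (1 / 2 : ℝ) < 1 by norm_num)
    have h1 := tendsto_zero_iff_norm_tendsto_zero.1 (h.tendsto_complCoeff_cofinite m)
    filter_upwards [h1.eventually_lt_const (half_pos hε)] with n hn
    rw [Real.dist_0_eq_abs, abs_norm]
    have h2 := norm_sub_norm_le (c n) (complCoeff F U m n)
    rw [norm_sub_rev] at h2
    linarith [hunif m n]
  obtain ⟨C, hC⟩ : ∃ C, ∀ n, ‖c n‖ ≤ C := by
    refine ⟨(∫ t, ‖(U 0)ᶜ.indicator (F 0) t‖ ∂torusHaar) + 10, fun n => ?_⟩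
    have h1 : ‖complCoeff F U 0 n‖ ≤ _ := norm_fourierCoeff_le_integral _ n
    have h2 := hunif 0 n
    have h3 := norm_sub_norm_le (c n) (complCoeff F U 0 n)
    rw [norm_sub_rev] at h3
    rw [pow_zero, mul_one] at h2
    linarith
  refine ⟨c, ⟨⟨0, ?_⟩, ?_⟩, ?_⟩
  · -- the mean of `F m` stays near `e`, while that of its restriction to `U m` is at most `2`
    have h1 (m : ℕ) : (1 / 10 : ℝ) ≤ ‖complCoeff F U m 0‖ := by
      have h2 : ‖fourierCoeff ((U m).indicator (F m)) 0‖ ≤ 2 := by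
        refine (norm_fourierCoeff_le_integral _ _).trans ?_
        refine (integral_mono (h.integrable_indicator m).norm (integrable_const (2 : ℝ))
          (h.norm_indicator_le m)).trans (by simp)
      have h3 := h.norm_coeff_zero_ge m
      have h4 := norm_sub_norm_le (coeffCLM 0 (F m)) (fourierCoeff ((U m).indicator (F m)) 0)
      rw [← h.complCoeff_eq_sub] at h4
      have : (0 : ℝ) < (1 / 2) ^ (m + 1) := by positivity
      linarith [Real.exp_one_gt_d9]
    have h5 := ge_of_tendsto' (hc 0).norm h1
    exact norm_pos_iff.1 (by linarith)
  · have hae : ∀ᵐ t ∂torusHaar, ∃ k, t ∈ U k := by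
      rw [ae_iff]
      have h1 (k : ℕ) : torusHaar.real {t | ¬∃ k, t ∈ U k} ≤ 2 * (1 / 2) ^ k := by
        have hsub : {t | ¬∃ k, t ∈ U k} ⊆ (U k)ᶜ := fun t ht hk => ht ⟨k, hk⟩
        exact (measureReal_mono hsub).trans (h.measure_compl_le k)
      have h2 : Tendsto (fun k : ℕ => 2 * (1 / 2 : ℝ) ^ k) atTop (𝓝 0) := by
        simpa using (tendsto_pow_atTop_nhds_zero_of_lt_one (by norm_num)
          (show (1 / 2 : ℝ) < 1 by norm_num)).const_mul 2
      have h3 := le_antisymm (ge_of_tendsto' h2 h1) measureReal_nonneg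
      rwa [measureReal_eq_zero_iff] at h3
    rw [volume_eq_smul_haarAddCircle]
    refine Measure.ae_smul_measure ?_ _
    filter_upwards [hae] with t ⟨k, hk⟩
    obtain ⟨ψ, hψt, hψU, hψs⟩ := exists_bump (h.isOpen k) hk
    have hψ1 : Summable fun l => ‖fourierCoeff ψ l‖ :=
      hψs.of_nonneg_of_le (fun l => norm_nonneg _) fun l =>
        le_mul_of_one_le_left (norm_nonneg _) (by linarith [abs_nonneg (l : ℝ)])
    refine tendsto_trigPartialSum_of_convolution_eq_zero hC hc0 hψs (fun n => ?_) (t := t) ?_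
    · have h1 : Tendsto (fun m => ∑' l, fourierCoeff ψ l * complCoeff F U m (n - l)) atTop
          (𝓝 (∑' l, fourierCoeff ψ l * c (n - l))) := by
        refine tendsto_tsum_of_dominated_convergence (hψ1.mul_right (C + 10))
          (fun l => (hc (n - l)).const_mul _) (Eventually.of_forall fun m l => ?_)
        rw [norm_mul]
        refine mul_le_mul_of_nonneg_left ?_ (norm_nonneg _)
        have h2 := norm_sub_norm_le (complCoeff F U m (n - l)) (c (n - l))
        have h3 : (1 / 2 : ℝ) ^ m ≤ 1 := pow_le_one₀ (by norm_num) (by norm_num)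
        linarith [hunif m (n - l), hC (n - l)]
      -- for `m ≥ k` the product of `ψ` and the restriction of `F m` to the complement of `U m` is zero
      refine tendsto_nhds_unique h1 (tendsto_const_nhds.congr' ?_)
      filter_upwards [eventually_ge_atTop k] with m hm
      refine (tsum_fourierCoeff_mul_eq_zero hψ1.of_norm (h.integrable_indicator_compl m)
        (fun s => ?_) n).symm
      by_cases hs : s ∈ U m
      · simp [hs]
      · rw [hψU s fun hk => hs (h.monotone hm hk), zero_mul]
    · have := (has_pointwise_sum_fourier_series_of_summable hψ1.of_norm t).tsum_eq
      simp only [smul_eq_mul] at this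
      rwa [this]
  · -- for `n < 0` only the restriction of `F m` to `U m`, bounded by `2`, contributes
    refine summable_of_sum_le (c := 4) (fun n => by positivity) fun s => ?_
    have h1 (m : ℕ) : ∑ n ∈ s, ‖complCoeff F U m n‖ ^ 2 ≤ 4 := by
      have hs := hasSum_sq_fourierCoeff_of_memLp (h.memLp_indicator m)
      have h2 (n : {n : ℤ // n < 0}) :
          ‖complCoeff F U m n‖ = ‖fourierCoeff ((U m).indicator (F m)) n‖ := by
        rw [h.complCoeff_eq_sub, coeffCLM_neg_of_mem (h.mem m) n.2, zero_sub, norm_neg]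
      simp only [h2]
      have h3 := sum_le_hasSum (s.map (Function.Embedding.subtype _)) (fun i _ => by positivity) hs
      rw [Finset.sum_map] at h3
      refine h3.trans ((integral_mono (h.memLp_indicator m).integrable_norm_pow' (integrable_const 4)
        fun t => ?_).trans (by simp))
      have := pow_le_pow_left₀ (norm_nonneg _) (h.norm_indicator_le m t) 2
      linarith
    exact le_of_tendsto' (tendsto_finsetSum s fun n _ => ((hc n).norm.pow 2)) h1
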